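/- Let $(X_t)_{t\ge 0}$ be the birth-death process on $\mathbb N=\{0,1,2,\dots\}$ with birth rates $\lambda_x$ and death rates $\nu_x$ (with $\nu_0=0$). Assume that it is irreducible, i.e. $\lambda_x>0$ for all $x\ge 0$ and $\nu_x>0$ for all $x\ge 1$, and non-explosive, and let $P_tf(x)=\mathbb E_x[f(X_t)]$. Let $u:\mathbb N\to(0,\infty)$, and put $$\partial_u f(x)=\frac{f(x+1)-f(x)}{u_x},\qquad \lambda^u_x=\frac{u_{x+1}}{u_x}\lambda_{x+1},\qquad \nu^u_x=\frac{u_{x-1}}{u_x}\nu_x\quad(\nu^u_0=0),$$ $$V_u(x)=\nu_{x+1}-\nu^u_x+\lambda_x-\lambda^u_x .$$ Let $(X_{u,t})_{t\ge 0}$ be the minimal birth-death process with birth rates $\lambda^u$ and death rates $\nu^u$. If it explodes, it is sent to a cemetery, and the random variables inside the expectations below are $0$ once explosion has occurred by time $t$. Assume that $V_u$ is bounded below, and let $f:\mathbb N\to\mathbb R$ satisfy $\sup_{y}|\partial_u f(y)|<\infty$. Then for all $x\in\mathbb N$ and $t\ge 0$, $f$ is integrable with respect to the law of $X_t$ under $\mathbb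 P_y$ for every $y\in\mathbb N$, the random variable in the following expectation is integrable, and $$\partial_u P_tf(x)=P^{V_u}_{u,t}\,\partial_u f(x):=\mathbb E_x\Big[\partial_u f(X_{u,t})\exp\Big(-\int_0^t V_u(X_{u,s})\,ds\Big)\Big].$$ If moreover $V_u\ge 0$, then for every differentiable convex function $\varphi:\mathbb R\to\mathbb R$ and every constant $c>0$ with $\varphi'(r)\,r\ge c\,\varphi(r)$ for all $r\in\mathbb R$, the random variable in the following expectation is integrable, and $$\varphi\big(\partial_u P_tf(x)\big)\le \mathbb E_x\Big[\varphi\big(\partial_u f(X_{u,t})\big)\exp\Big(-\int_0^t c\,V_u(X_{u,s})\,ds\Big)\Big].$$ -/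

import Mathlib

open MeasureTheory ProbabilityTheory Set Filter

namespace BirthDeath

noncomputable section

/-- Irreducibility of the birth-death process on `ℕ` with birth rates `lam` and death rates `nu`:
every nearest-neighbour jump inside `ℕ` has positive rate, and there is no jump from `0` to `-1`. -/
structure IsIrreducible (lam nu : ℕ → ℝ) : Prop where
  birth_pos : ∀ x, 0 < lam x
  death_zero : nu 0 = 0
  death_pos : ∀ x, 0 < nu (x + 1)

/-! ### The minimal birth-death process, from its embedded jump chain and its holding times -/

/-- Sequences of pairs: the `n`-th pair drives the `n`-th holding time and the `n`-th jump. -/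
abbrev Noise : Type := ℕ → ℝ × unitInterval

/-- The law of an i.i.d. sequence of independent pairs (standard exponential, uniform on `[0,1]`). -/
def noise : Measure Noise :=
  Measure.infinitePi fun _ : ℕ => (expMeasure 1).prod (volume : Measure unitInterval)

instance : IsProbabilityMeasure (expMeasure 1) := isProbabilityMeasure_expMeasure one_pos

instance : IsProbabilityMeasure noise := by
  unfold noise
  infer_instance

/-- The embedded jump chain started at `x`: from `y` it jumps to `y + 1` with probability
`lam y / (lam y + nu y)`, and to `y - 1` otherwise. -/
def chain (lam nu : ℕ → ℝ) (x : ℕ) (ω : Noise) : ℕ → ℕ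
  | 0 => x
  | n + 1 =>
    let y := chain lam nu x ω n
    if ((ω n).2 : ℝ) ≤ lam y / (lam y + nu y) then y + 1 else y - 1

/-- The `n`-th holding time, exponential of parameter `lam y + nu y` given that the chain is
at `y` after `n` jumps. -/
def holdingTime (lam nu : ℕ → ℝ) (x : ℕ) (ω : Noise) (n : ℕ) : ℝ :=
  (ω n).1 / (lam (chain lam nu x ω n) + nu (chain lam nu x ω n))

/-- The time of the `n`-th jump (with `jumpTime 0 = 0`). -/
def jumpTime (lam nu : ℕ → ℝ) (x : ℕ) (ω : Noise) (n : ℕ) : ℝ :=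
  ∑ k ∈ Finset.range n, holdingTime lam nu x ω k

open Classical in
/-- The minimal birth-death process started at `x`, at time `t`: the state of the jump chain after
the jumps performed up to time `t`, or the cemetery `none` if explosion occurred by time `t`. -/
def process (lam nu : ℕ → ℝ) (x : ℕ) (t : ℝ) (ω : Noise) : Option ℕ :=
  if h : ∃ n, t < jumpTime lam nu x ω (n + 1) then some (chain lam nu x ω (Nat.find h)) else none

/-- Non-explosion: from every starting point, almost surely the jump times tend to infinity. -/
def NonExplosive (lam nu : ℕ → ℝ) : Prop :=
  ∀ x, ∀ᵐ ω ∂noise, Tendsto (jumpTime lam nu x ω) atTop atTop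

/-- Extension of a function on `ℕ` by `0` at the cemetery. -/
def ext (g : ℕ → ℝ) : Option ℕ → ℝ
  | none => 0
  | some y => g y

/-- The semigroup `P_t f (x) = E_x[f(X_t)]`. -/
def semigroup (lam nu : ℕ → ℝ) (t : ℝ) (f : ℕ → ℝ) (x : ℕ) : ℝ :=
  ∫ ω, ext f (process lam nu x t ω) ∂noise

/-- The random variable `g(X_t) exp(-∫_0^t V(X_s) ds)` for the process started at `x`; it vanishes
if explosion occurred by time `t`. -/
def feynmanKacWeight (lam nu V : ℕ → ℝ) (t : ℝ) (g : ℕ → ℝ) (x : ℕ) (ω : Noise) : ℝ :=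
  ext g (process lam nu x t ω) * Real.exp (-∫ s in (0 : ℝ)..t, ext V (process lam nu x s ω))

/-- The Feynman-Kac semigroup with potential `V`:
`P^V_t g (x) = E_x[g(X_t) exp(-∫_0^t V(X_s) ds)]`. -/
def feynmanKac (lam nu V : ℕ → ℝ) (t : ℝ) (g : ℕ → ℝ) (x : ℕ) : ℝ :=
  ∫ ω, feynmanKacWeight lam nu V t g x ω ∂noise

/-! ### The `u`-modification, the weighted gradient and the potential -/

/-- Birth rates of the `u`-modification. -/
def modBirth (lam u : ℕ → ℝ) (x : ℕ) : ℝ := u (x + 1) / u x * lam (x + 1)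

/-- Death rates of the `u`-modification (zero at `0` as soon as `nu 0 = 0`). -/
def modDeath (nu u : ℕ → ℝ) (x : ℕ) : ℝ := u (x - 1) / u x * nu x

/-- The weighted discrete gradient `∂_u f (x) = (f (x + 1) - f x) / u x`. -/
def grad (u f : ℕ → ℝ) (x : ℕ) : ℝ := (f (x + 1) - f x) / u x

/-- The potential `V_u`. -/
def potential (lam nu u : ℕ → ℝ) (x : ℕ) : ℝ :=
  nu (x + 1) - modDeath nu u x + lam x - modBirth lam u x

end

end BirthDeath

/-! The gradient of the generator is a killed generator: with `h` in place of `∂_u f`, `∂_u L f`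
becomes `L_u h - V_u h`, where `L_u` has the modified rates. In the backward equation of the
Feynman-Kac semigroup the total rate `λ^u + ν^u + V_u` collapses to `λ_x + ν_{x+1}`. Let `h` be the
Feynman-Kac semigroup applied to the gradient `g` of `f`, where `f 0 = 0`. Summing back, `v(t,x) =
λ_0 u_0 ∫_0^t h(s,0) ds + Σ_{z<x} u_z h(t,z)` solves the backward equation of the original process,
by telescoping of fluxes (`generator_sum`), and starts from `f`. The intertwining is therefore a
uniqueness statement: `v = P_t f`.

Uniqueness among bounded solutions comes from non-explosion (`nonneg_of_supersolution`). The
difficulty is that `v` is not known to be bounded, and the modified process may explode. Take first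
`g ≥ 0` of finite support. The semigroups are increasing limits of Picard iterates, whose
probabilistic meaning is "fewer than `k` jumps by time `t`" (`lintegral_truncWeight`). Replacing `h`
by an iterate gives a finitely supported sum, hence a bounded subsolution lying below `P_t f`. In
the limit `v` is bounded, and comparison in both directions gives equality
(`eq_of_tendsto_picard_of_finite_support`).

Monotone convergence then removes the support condition (`intertwining_of_nonneg`), with
integrability coming from a bound uniform in the truncation, and adding a constant to the gradient
removes its sign.

The convex inequality is Jensen's inequality followed by `φ(r e^{-a}) ≤ φ(r) e^{-ca}` for `a ≥ 0`,
which is Grönwall applied to `c φ(r) ≤ φ'(r) r`. -/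

open scoped Topology

namespace BirthDeath

/-! ### Picard iterates of the backward equation -/

/-- The Picard iterates, started from `0`, of the backward equation
`∂ₜ S t x = -κ x * S t x + b x * S t (x + 1) + d x * S t (x - 1)` with initial value `g`. -/
noncomputable def picard (b d κ g : ℕ → ℝ) : ℕ → ℝ → ℕ → ℝ
  | 0, _, _ => 0
  | k + 1, t, x => Real.exp (-(κ x * t)) * (g x + ∫ s in (0 : ℝ)..t, Real.exp (κ x * s) *
      (b x * picard b d κ g k s (x + 1) + d x * picard b d κ g k s (x - 1)))

section Picard

variable {b d κ g : ℕ → ℝ}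

@[simp] theorem picard_zero (t : ℝ) (x : ℕ) : picard b d κ g 0 t x = 0 := rfl

theorem picard_succ (k : ℕ) (t : ℝ) (x : ℕ) :
    picard b d κ g (k + 1) t x = Real.exp (-(κ x * t)) *
      (g x + ∫ s in (0 : ℝ)..t, Real.exp (κ x * s) *
        (b x * picard b d κ g k s (x + 1) + d x * picard b d κ g k s (x - 1))) := rfl

@[simp] theorem picard_succ_at_zero (k : ℕ) (x : ℕ) : picard b d κ g (k + 1) 0 x = g x := by
  simp [picard_succ]

theorem continuous_picard (k x : ℕ) : Continuous fun t => picard b d κ g k t x := by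
  induction k generalizing x with
  | zero => simpa using continuous_const
  | succ k ih =>
    simp only [picard_succ]
    have h1 := ih (x + 1)
    have h2 := ih (x - 1)
    refine Continuous.mul (by fun_prop) (continuous_const.add ?_)
    refine intervalIntegral.continuous_primitive (fun a c => ?_) 0
    exact Continuous.intervalIntegrable (by fun_prop) a c

theorem hasDerivAt_picard_succ (k x : ℕ) (t : ℝ) :
    HasDerivAt (fun t => picard b d κ g (k + 1) t x)
      (-κ x * picard b d κ g (k + 1) t x +
        (b x * picard b d κ g k t (x + 1) + d x * picard b d κ g k t (x - 1))) t := by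
  have h1 := continuous_picard (b := b) (d := d) (κ := κ) (g := g) k (x + 1)
  have h2 := continuous_picard (b := b) (d := d) (κ := κ) (g := g) k (x - 1)
  have hc : Continuous fun s => Real.exp (κ x * s) *
      (b x * picard b d κ g k s (x + 1) + d x * picard b d κ g k s (x - 1)) := by fun_prop
  have hI := (hc.integral_hasStrictDerivAt 0 t).hasDerivAt.const_add (g x)
  have hE : HasDerivAt (fun t => Real.exp (-(κ x * t))) (Real.exp (-(κ x * t)) * -(κ x * 1)) t :=
    ((hasDerivAt_id t).const_mul (κ x)).neg.exp
  have h := hE.mul hI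
  simp only [picard_succ]
  refine h.congr_deriv ?_
  have : Real.exp (-(κ x * t)) * Real.exp (κ x * t) = 1 := by rw [← Real.exp_add]; simp
  linear_combination (b x * picard b d κ g k t (x + 1) + d x * picard b d κ g k t (x - 1)) * this

/-- A function with `ρ' ≥ -a ρ` and `ρ 0 ≥ 0` is nonnegative. -/
theorem nonneg_of_neg_mul_le_deriv {ρ ρ' : ℝ → ℝ} {a T : ℝ} (hT : 0 ≤ T)
    (hc : ContinuousOn ρ (Icc 0 T)) (hd : ∀ t ∈ Ioo 0 T, HasDerivAt ρ (ρ' t) t)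
    (h : ∀ t ∈ Ioo 0 T, -a * ρ t ≤ ρ' t) (h0 : 0 ≤ ρ 0) : 0 ≤ ρ T := by
  have hder : ∀ t ∈ Ioo 0 T, HasDerivAt (fun t => Real.exp (a * t) * ρ t)
      (Real.exp (a * t) * (a * 1) * ρ t + Real.exp (a * t) * ρ' t) t := fun t ht =>
    (((hasDerivAt_id t).const_mul a).exp).mul (hd t ht)
  have hm : MonotoneOn (fun t => Real.exp (a * t) * ρ t) (Icc 0 T) := by
    refine monotoneOn_of_deriv_nonneg (convex_Icc 0 T)
      (ContinuousOn.mul (by fun_prop) hc) ?_ ?_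
    · rw [interior_Icc]
      exact fun t ht => (hder t ht).differentiableAt.differentiableWithinAt
    · rw [interior_Icc]
      intro t ht
      rw [(hder t ht).deriv]
      have := mul_nonneg (Real.exp_pos (a * t)).le (sub_nonneg.2 (h t ht))
      linarith
  have := hm (left_mem_Icc.2 hT) (right_mem_Icc.2 hT) hT
  simp only [mul_zero, Real.exp_zero, one_mul] at this
  exact nonneg_of_mul_nonneg_right (h0.trans this) (Real.exp_pos _)

theorem picard_nonneg (hb : ∀ x, 0 ≤ b x) (hd : ∀ x, 0 ≤ d x) (hg : ∀ x, 0 ≤ g x)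
    (k x : ℕ) {t : ℝ} (ht : 0 ≤ t) : 0 ≤ picard b d κ g k t x := by
  induction k generalizing x t with
  | zero => simp
  | succ k ih =>
    rw [picard_succ]
    refine mul_nonneg (Real.exp_pos _).le (add_nonneg (hg x) ?_)
    refine intervalIntegral.integral_nonneg ht fun s hs => ?_
    have h1 := ih (x + 1) hs.1
    have h2 := ih (x - 1) hs.1
    have := hb x
    have := hd x
    positivity

theorem picard_le_succ (hb : ∀ x, 0 ≤ b x) (hd : ∀ x, 0 ≤ d x) (hg : ∀ x, 0 ≤ g x)
    (k x : ℕ) {t : ℝ} (ht : 0 ≤ t) : picard b d κ g k t x ≤ picard b d κ g (k + 1) t x := by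
  induction k generalizing x t with
  | zero => exact picard_nonneg hb hd hg _ _ ht
  | succ k ih =>
    rw [picard_succ (k + 1), picard_succ k]
    have hc : ∀ j, Continuous fun s => Real.exp (κ x * s) *
        (b x * picard b d κ g j s (x + 1) + d x * picard b d κ g j s (x - 1)) := fun j => by
      have h1 := continuous_picard (b := b) (d := d) (κ := κ) (g := g) j (x + 1)
      have h2 := continuous_picard (b := b) (d := d) (κ := κ) (g := g) j (x - 1)
      fun_prop
    gcongr
    refine intervalIntegral.integral_mono_on ht ((hc _).intervalIntegrable _ _)
      ((hc _).intervalIntegrable _ _) fun s hs => ?_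
    have h1 := ih (x + 1) hs.1
    have h2 := ih (x - 1) hs.1
    have := hb x
    have := hd x
    gcongr

/-- The function `C * exp (K t)` is a supersolution of the backward equation, because `hκ` says that
the potential `κ - b - d` is at least `-K`. -/
theorem picard_le_mul_exp {C K : ℝ} (hb : ∀ x, 0 ≤ b x) (hd : ∀ x, 0 ≤ d x) (hC : 0 ≤ C)
    (hg : ∀ x, g x ≤ C) (hκ : ∀ x, b x + d x ≤ κ x + K)
    (k x : ℕ) {t : ℝ} (ht : 0 ≤ t) : picard b d κ g k t x ≤ C * Real.exp (K * t) := by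
  induction k generalizing x t with
  | zero => simp only [picard_zero]; positivity
  | succ k ih =>
    have hder : ∀ s, HasDerivAt (fun s => C * Real.exp (K * s)) (C * (Real.exp (K * s) * (K * 1))) s :=
      fun s => ((hasDerivAt_id s).const_mul K).exp.const_mul C
    rw [← sub_nonneg]
    refine nonneg_of_neg_mul_le_deriv (ρ := fun t => C * Real.exp (K * t) - picard b d κ g (k + 1) t x)
      (a := κ x) ht ?_ (fun s _ => (hder s).sub (hasDerivAt_picard_succ k x s)) ?_ ?_
    · have := continuous_picard (b := b) (d := d) (κ := κ) (g := g) (k + 1) x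
      fun_prop
    · intro s hs
      have h1 := mul_le_mul_of_nonneg_left (ih (x + 1) hs.1.le) (hb x)
      have h2 := mul_le_mul_of_nonneg_left (ih (x - 1) hs.1.le) (hd x)
      have h3 := mul_le_mul_of_nonneg_right (hκ x) (by positivity : 0 ≤ C * Real.exp (K * s))
      linarith
    · simpa using hg x

/-- Each iteration looks only at nearest neighbours, so the support grows by at most one site. This
is what keeps the truncated sums bounded in `x`. -/
theorem picard_eq_zero_of_le {Y : ℕ} (hg : ∀ x, Y ≤ x → g x = 0) (k x : ℕ) (t : ℝ)
    (hx : Y + k ≤ x) : picard b d κ g k t x = 0 := by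
  induction k generalizing x t with
  | zero => simp
  | succ k ih =>
    have h1 : ∀ s, picard b d κ g k s (x + 1) = 0 := fun s => ih _ s (by omega)
    have h2 : ∀ s, picard b d κ g k s (x - 1) = 0 := fun s => ih _ s (by omega)
    simp [picard_succ, h1, h2, hg x (by omega)]

/-! ### Passing to the limit in the backward equation -/

theorem continuousOn_primitive_Ici {F : ℝ → ℝ}
    (hF : ∀ T, 0 ≤ T → IntervalIntegrable F volume 0 T) :
    ContinuousOn (fun t => ∫ s in (0 : ℝ)..t, F s) (Ici 0) := by
  intro t ht
  have ht' : (0 : ℝ) ≤ t + 1 := by linarith [mem_Ici.1 ht]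
  have hc := intervalIntegral.continuousOn_primitive_interval' (hF (t + 1) ht') left_mem_uIcc
  rw [uIcc_of_le ht'] at hc
  refine (hc t ⟨ht, by linarith⟩).mono_of_mem_nhdsWithin ?_
  exact mem_nhdsWithin.2 ⟨Iio (t + 1), isOpen_Iio, by simp, fun s hs => ⟨hs.2, le_of_lt hs.1⟩⟩

theorem hasDerivAt_primitive_of_continuousOn_Ici {F : ℝ → ℝ} (hF : ContinuousOn F (Ici 0))
    {t : ℝ} (ht : 0 < t) : HasDerivAt (fun t => ∫ s in (0 : ℝ)..t, F s) (F t) t :=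
  intervalIntegral.integral_hasDerivAt_right
    ((hF.mono (by rw [uIcc_of_le ht.le]; exact Icc_subset_Ici_self)).intervalIntegrable)
    ((hF.mono Ioi_subset_Ici_self).stronglyMeasurableAtFilter isOpen_Ioi t ht)
    (hF.continuousAt (Ici_mem_nhds ht))

/-- A locally bounded limit of the Picard iterates solves the backward equation. -/
theorem hasDerivAt_of_tendsto_picard {S : ℝ → ℕ → ℝ} {C K : ℝ} (hK : 0 ≤ K)
    (hS : ∀ t, 0 ≤ t → ∀ x, Tendsto (fun k => picard b d κ g k t x) atTop (𝓝 (S t x)))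
    (hC : ∀ k x t, 0 ≤ t → |picard b d κ g k t x| ≤ C * Real.exp (K * t)) (x : ℕ) :
    ContinuousOn (fun t => S t x) (Ici 0) ∧ ∀ t, 0 < t → HasDerivAt (fun t => S t x)
      (-κ x * S t x + (b x * S t (x + 1) + d x * S t (x - 1))) t := by
  have hC0 : 0 ≤ C := by simpa using (abs_nonneg _).trans (hC 0 0 0 le_rfl)
  set F : ℕ → ℕ → ℝ → ℝ := fun x k t => -κ x * picard b d κ g (k + 1) t x +
    (b x * picard b d κ g k t (x + 1) + d x * picard b d κ g k t (x - 1)) with hF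
  set G : ℕ → ℝ → ℝ := fun x t => -κ x * S t x + (b x * S t (x + 1) + d x * S t (x - 1)) with hG
  have hFc : ∀ x k, Continuous (F x k) := fun x k => by
    have h0 := continuous_picard (b := b) (d := d) (κ := κ) (g := g) (k + 1) x
    have h1 := continuous_picard (b := b) (d := d) (κ := κ) (g := g) k (x + 1)
    have h2 := continuous_picard (b := b) (d := d) (κ := κ) (g := g) k (x - 1)
    simp only [hF]
    fun_prop
  have hFG : ∀ x t, 0 ≤ t → Tendsto (fun k => F x k t) atTop (𝓝 (G x t)) := fun x t ht =>
    (((hS t ht x).comp (tendsto_add_atTop_nat 1)).const_mul _).add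
      (((hS t ht _).const_mul _).add ((hS t ht _).const_mul _))
  have hFb : ∀ x k T t, t ∈ Icc 0 T →
      ‖F x k t‖ ≤ (|κ x| + |b x| + |d x|) * (C * Real.exp (K * T)) := by
    intro x k T t ht
    have hb : ∀ k x, |picard b d κ g k t x| ≤ C * Real.exp (K * T) := fun k x =>
      (hC k x t ht.1).trans (by have := ht.2; gcongr)
    calc ‖F x k t‖ ≤ |-κ x * picard b d κ g (k + 1) t x| +
          (|b x * picard b d κ g k t (x + 1)| + |d x * picard b d κ g k t (x - 1)|) :=
          (abs_add_le _ _).trans (add_le_add le_rfl (abs_add_le _ _))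
      _ = |κ x| * |picard b d κ g (k + 1) t x| +
          (|b x| * |picard b d κ g k t (x + 1)| + |d x| * |picard b d κ g k t (x - 1)|) := by
          simp only [abs_mul, abs_neg]
      _ ≤ |κ x| * (C * Real.exp (K * T)) +
          (|b x| * (C * Real.exp (K * T)) + |d x| * (C * Real.exp (K * T))) := by
          gcongr <;> apply hb
      _ = _ := by ring
  have hGb : ∀ x T t, t ∈ Icc 0 T →
      ‖G x t‖ ≤ (|κ x| + |b x| + |d x|) * (C * Real.exp (K * T)) := fun x T t ht =>
    le_of_tendsto (hFG x t ht.1).norm (Eventually.of_forall fun k => hFb x k T t ht)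
  -- Regularity is bootstrapped: `G` is measurable as a limit, the integral equation follows by
  -- dominated convergence, hence `S` is continuous, hence so is `G`, and the integral equation can
  -- be differentiated.
  have hGm : ∀ x T, 0 ≤ T → AEStronglyMeasurable (G x) (volume.restrict (uIoc 0 T)) := by
    intro x T hT
    refine aestronglyMeasurable_of_tendsto_ae atTop (f := F x)
      (fun k => (hFc x k).aestronglyMeasurable) ?_
    filter_upwards [ae_restrict_mem measurableSet_uIoc] with t ht
    rw [uIoc_of_le hT] at ht
    exact hFG x t ht.1.le
  have hGi : ∀ x T, 0 ≤ T → IntervalIntegrable (G x) volume 0 T := by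
    intro x T hT
    refine (intervalIntegrable_const (c := (|κ x| + |b x| + |d x|) * (C * Real.exp (K * T)))).mono_fun'
      (hGm x T hT) ?_
    filter_upwards [ae_restrict_mem measurableSet_uIoc] with t ht
    rw [uIoc_of_le hT] at ht
    exact hGb x T t ⟨ht.1.le, ht.2⟩
  have hint : ∀ x T, 0 ≤ T → S T x = g x + ∫ s in (0 : ℝ)..T, G x s := by
    intro x T hT
    have h1 : Tendsto (fun k => ∫ s in (0 : ℝ)..T, F x k s) atTop (𝓝 (∫ s in (0 : ℝ)..T, G x s)) := by
      refine intervalIntegral.tendsto_integral_filter_of_dominated_convergence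
        (fun _ => (|κ x| + |b x| + |d x|) * (C * Real.exp (K * T)))
        (Eventually.of_forall fun k => (hFc x k).aestronglyMeasurable)
        (Eventually.of_forall fun k => ae_of_all _ fun t ht => ?_) intervalIntegrable_const
        (ae_of_all _ fun t ht => ?_)
      · rw [uIoc_of_le hT] at ht
        exact hFb x k T t ⟨ht.1.le, ht.2⟩
      · rw [uIoc_of_le hT] at ht
        exact hFG x t ht.1.le
    have h2 : ∀ k, picard b d κ g (k + 1) T x = g x + ∫ s in (0 : ℝ)..T, F x k s := by
      intro k
      rw [intervalIntegral.integral_eq_sub_of_hasDerivAt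
        (fun s _ => hasDerivAt_picard_succ k x s) ((hFc x k).intervalIntegrable 0 T)]
      simp
    have h3 := (hS T hT x).comp (tendsto_add_atTop_nat 1)
    refine tendsto_nhds_unique h3 ?_
    simp only [Function.comp_def, h2]
    exact h1.const_add _
  have hcont : ∀ x, ContinuousOn (fun t => S t x) (Ici 0) := by
    intro x
    refine ContinuousOn.congr (f := fun t => g x + ∫ s in (0 : ℝ)..t, G x s) ?_ (fun t ht => hint x t ht)
    exact continuousOn_const.add (continuousOn_primitive_Ici (hGi x))
  refine ⟨hcont x, fun t ht => ?_⟩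
  have hGc : ContinuousOn (G x) (Ici 0) :=
    (continuousOn_const.mul (hcont x)).add
      ((continuousOn_const.mul (hcont _)).add (continuousOn_const.mul (hcont _)))
  have := (hasDerivAt_primitive_of_continuousOn_Ici hGc ht).const_add (g x)
  refine this.congr_of_eventuallyEq ?_
  filter_upwards [Ioi_mem_nhds ht] with s hs
  exact hint x s (le_of_lt hs)

end Picard

/-! ### Comparison principle for a non-explosive process -/

/-- Bounded supersolutions of the backward equation with nonnegative initial value are
nonnegative, when the Picard iterates started from `1` converge to `1`. -/
theorem nonneg_of_supersolution {lam nu : ℕ → ℝ} (hlam : ∀ x, 0 ≤ lam x) (hnu : ∀ x, 0 ≤ nu x)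
    (hone : ∀ t, 0 ≤ t → ∀ x, Tendsto
      (fun k => picard lam nu (fun y => lam y + nu y) (fun _ => 1) k t x) atTop (𝓝 1))
    {r r' : ℝ → ℕ → ℝ} {C T : ℝ} (hbd : ∀ t ∈ Icc 0 T, ∀ x, -C ≤ r t x)
    (hcont : ∀ x, ContinuousOn (fun t => r t x) (Ici 0))
    (hder : ∀ x t, 0 < t → HasDerivAt (fun t => r t x) (r' t x) t)
    (hsup : ∀ x t, 0 < t →
      lam x * (r t (x + 1) - r t x) + nu x * (r t (x - 1) - r t x) ≤ r' t x)
    (h0 : ∀ x, 0 ≤ r 0 x) {t : ℝ} (ht : t ∈ Icc 0 T) (x : ℕ) : 0 ≤ r t x := by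
  set B := picard lam nu (fun y => lam y + nu y) (fun _ => 1)
  -- Here `B k t x` plays the role of the probability of fewer than `k` jumps by time `t`, so the
  -- lower bound `-C` is only paid on paths with at least `k` jumps.
  have key : ∀ k x t, t ∈ Icc 0 T → 0 ≤ r t x + C * (1 - B k t x) := by
    intro k
    induction k with
    | zero => intro x t ht; have := hbd t ht x; simp only [B, picard_zero]; linarith
    | succ k ih =>
      intro x t ht
      refine nonneg_of_neg_mul_le_deriv (ρ := fun t => r t x + C * (1 - B (k + 1) t x))
        (a := lam x + nu x) ht.1 ?_ (fun s hs => (hder x s hs.1).add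
          (((hasDerivAt_picard_succ k x s).const_sub 1).const_mul C)) ?_ ?_
      · have h1 := (hcont x).mono (Icc_subset_Ici_self : Icc 0 t ⊆ Ici 0)
        have h2 : Continuous fun t => B (k + 1) t x := continuous_picard (k + 1) x
        exact h1.add (by fun_prop)
      · intro s hs
        have hs' : s ∈ Icc 0 T := ⟨hs.1.le, hs.2.le.trans ht.2⟩
        have h1 := mul_nonneg (hlam x) (ih (x + 1) s hs')
        have h2 := mul_nonneg (hnu x) (ih (x - 1) s hs')
        have h3 := hsup x s hs.1
        simp only [B] at h1 h2 ⊢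
        linarith
      · simp only [B, picard_succ_at_zero]
        simpa using h0 x
  have hlim : Tendsto (fun k => r t x + C * (1 - B k t x)) atTop (𝓝 (r t x + C * (1 - 1))) :=
    (((hone t ht.1 x).const_sub 1).const_mul C).const_add _
  have := ge_of_tendsto' hlim fun k => key k x t ht
  simpa using this

/-! ### Intertwining for finitely supported gradients -/

/-- Each summand is the increment `J (z + 1) - J z` of the flux `J z = lam z * w z - nu z * w (z -
1)`, and `J 0 = lam 0 * w 0` because `nu 0 = 0`. -/
theorem telescope_generator {lam nu : ℕ → ℝ} (hnu : nu 0 = 0) (w : ℕ → ℝ) (x : ℕ) :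
    lam 0 * w 0 + ∑ z ∈ Finset.range x,
      (-(lam z + nu (z + 1)) * w z + (lam (z + 1) * w (z + 1) + nu z * w (z - 1))) =
    lam x * w x - nu x * w (x - 1) := by
  induction x with
  | zero => simp [hnu]
  | succ x ih =>
    rw [Finset.sum_range_succ, ← add_assoc, ih, Nat.add_sub_cancel]
    ring

/-- Summing `(∂_u)` back: the generator of the original process applied to a function with
weighted gradient `h`. -/
theorem generator_sum {lam nu u : ℕ → ℝ} (hnu : nu 0 = 0) (hu : ∀ x, 0 < u x) (h : ℕ → ℝ) (c : ℝ)
    (x : ℕ) :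
    lam 0 * u 0 * h 0 + ∑ z ∈ Finset.range x, u z * (-(lam z + nu (z + 1)) * h z +
      (modBirth lam u z * h (z + 1) + modDeath nu u z * h (z - 1))) =
    lam x * ((c + ∑ z ∈ Finset.range (x + 1), u z * h z) - (c + ∑ z ∈ Finset.range x, u z * h z)) +
    nu x * ((c + ∑ z ∈ Finset.range (x - 1), u z * h z) -
      (c + ∑ z ∈ Finset.range x, u z * h z)) := by
  have h1 : ∀ z, u z * (-(lam z + nu (z + 1)) * h z +
      (modBirth lam u z * h (z + 1) + modDeath nu u z * h (z - 1))) =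
      -(lam z + nu (z + 1)) * (u z * h z) +
        (lam (z + 1) * (u (z + 1) * h (z + 1)) + nu z * (u (z - 1) * h (z - 1))) := by
    intro z
    have := (hu z).ne'
    simp only [modBirth, modDeath]
    field_simp
  simp only [h1]
  have h2 := telescope_generator (lam := lam) hnu (fun z => u z * h z) x
  rw [mul_assoc, h2, Finset.sum_range_succ]
  rcases x with _ | x
  · simp [hnu]
  · rw [Nat.add_sub_cancel, Finset.sum_range_succ]
    ring

theorem IsIrreducible.death_nonneg {lam nu : ℕ → ℝ} (h : IsIrreducible lam nu) (x : ℕ) :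
    0 ≤ nu x := by
  rcases x with _ | x
  · exact h.death_zero.ge
  · exact (h.death_pos x).le

theorem modBirth_pos {lam nu u : ℕ → ℝ} (h : IsIrreducible lam nu) (hu : ∀ x, 0 < u x) (x : ℕ) :
    0 < modBirth lam u x :=
  mul_pos (div_pos (hu _) (hu _)) (h.birth_pos _)

theorem modDeath_nonneg {lam nu u : ℕ → ℝ} (h : IsIrreducible lam nu) (hu : ∀ x, 0 < u x) (x : ℕ) :
    0 ≤ modDeath nu u x :=
  mul_nonneg (div_pos (hu _) (hu _)).le (h.death_nonneg _)

theorem sum_range_le_of_support {w g : ℕ → ℝ} (hw : ∀ x, 0 < w x) (hg : ∀ x, 0 ≤ g x) {Y : ℕ}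
    (hgY : ∀ x, Y ≤ x → g x = 0) (x : ℕ) :
    ∑ z ∈ Finset.range x, w z * g z ≤ ∑ z ∈ Finset.range Y, w z * g z := by
  rcases le_total x Y with hx | hx
  · exact Finset.sum_le_sum_of_subset_of_nonneg (Finset.range_mono hx)
      fun z _ _ => mul_nonneg (hw z).le (hg z)
  · refine (Finset.sum_subset (Finset.range_mono hx) fun z _ hz => ?_).ge
    rw [hgY z (by simpa using hz), mul_zero]

/-- Both sides solve the backward equation of the original process with the same initial value. The
right side must first be shown to be bounded, via the Picard iterates of `h`. -/
theorem eq_of_tendsto_picard_of_finite_support {lam nu u g : ℕ → ℝ} (hirr : IsIrreducible lam nu)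
    (hone : ∀ t, 0 ≤ t → ∀ x, Tendsto
      (fun k => picard lam nu (fun y => lam y + nu y) (fun _ => 1) k t x) atTop (𝓝 1))
    (hu : ∀ x, 0 < u x) (hg : ∀ x, 0 ≤ g x) {Y : ℕ} (hgY : ∀ x, Y ≤ x → g x = 0) {C K : ℝ}
    (hK : 0 ≤ K) (hgC : ∀ x, g x ≤ C) (hV : ∀ x, -K ≤ potential lam nu u x) {h p : ℝ → ℕ → ℝ}
    (hh : ∀ t, 0 ≤ t → ∀ x, Tendsto (fun k => picard (modBirth lam u) (modDeath nu u)
      (fun y => lam y + nu (y + 1)) g k t x) atTop (𝓝 (h t x)))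
    (hp : ∀ t, 0 ≤ t → ∀ x, Tendsto (fun k => picard lam nu (fun y => lam y + nu y)
      (fun x => ∑ z ∈ Finset.range x, u z * g z) k t x) atTop (𝓝 (p t x)))
    {t : ℝ} (ht : 0 ≤ t) (x : ℕ) :
    p t x = lam 0 * u 0 * (∫ s in (0 : ℝ)..t, h s 0) + ∑ z ∈ Finset.range x, u z * h t z := by
  have hC : 0 ≤ C := (hg 0).trans (hgC 0)
  have hb : ∀ x, 0 ≤ modBirth lam u x := fun x => (modBirth_pos hirr hu x).le
  have hd : ∀ x, 0 ≤ modDeath nu u x := modDeath_nonneg hirr hu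
  have hlam : ∀ x, 0 ≤ lam x := fun x => (hirr.birth_pos x).le
  have hlu : 0 ≤ lam 0 * u 0 := mul_nonneg (hlam 0) (hu 0).le
  have hnu := hirr.death_nonneg
  set f : ℕ → ℝ := fun x => ∑ z ∈ Finset.range x, u z * g z with hf
  set H := picard (modBirth lam u) (modDeath nu u) (fun y => lam y + nu (y + 1)) g
  set P := picard lam nu (fun y => lam y + nu y) f
  have hf0 : ∀ x, 0 ≤ f x := fun x => Finset.sum_nonneg fun z _ => mul_nonneg (hu z).le (hg z)
  have hfD : ∀ x, f x ≤ f Y := sum_range_le_of_support hu hg hgY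
  have hH0 : ∀ k x t, 0 ≤ t → 0 ≤ H k t x := fun k x t ht => picard_nonneg hb hd hg k x ht
  have hP0 : ∀ k x t, 0 ≤ t → 0 ≤ P k t x := fun k x t ht => picard_nonneg hlam hnu hf0 k x ht
  have hHC : ∀ k x t, 0 ≤ t → H k t x ≤ C * Real.exp (K * t) := fun k x t ht =>
    picard_le_mul_exp hb hd hC hgC (fun x => by have := hV x; simp only [potential] at this; linarith)
      k x ht
  have hPD : ∀ k x t, 0 ≤ t → P k t x ≤ f Y * Real.exp (0 * t) := fun k x t ht =>
    picard_le_mul_exp hlam hnu (hf0 Y) hfD (fun x => by simp) k x ht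
  have hh0 : ∀ x t, 0 ≤ t → 0 ≤ h t x := fun x t ht => ge_of_tendsto' (hh t ht x) fun k => hH0 k x t ht
  have hp0 : ∀ x t, 0 ≤ t → 0 ≤ p t x := fun x t ht => ge_of_tendsto' (hp t ht x) fun k => hP0 k x t ht
  have hpD : ∀ x t, 0 ≤ t → p t x ≤ f Y := fun x t ht =>
    le_of_tendsto' (hp t ht x) fun k => by simpa using hPD k x t ht
  have hhC : ∀ x t, 0 ≤ t → h t x ≤ C * Real.exp (K * t) := fun x t ht =>
    le_of_tendsto' (hh t ht x) fun k => hHC k x t ht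
  have hsolh := hasDerivAt_of_tendsto_picard hK hh
    (fun k x t ht => by rw [abs_of_nonneg (hH0 k x t ht)]; exact hHC k x t ht)
  have hsolp := hasDerivAt_of_tendsto_picard le_rfl hp
    (fun k x t ht => by rw [abs_of_nonneg (hP0 k x t ht)]; exact hPD k x t ht)
  have hp_zero : ∀ x, p 0 x = f x := fun x => tendsto_nhds_unique (hp 0 le_rfl x)
    ((tendsto_add_atTop_iff_nat 1).1 (by simp [P]))
  have hh_zero : ∀ x, h 0 x = g x := fun x => tendsto_nhds_unique (hh 0 le_rfl x)
    ((tendsto_add_atTop_iff_nat 1).1 (by simp [H]))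
  -- the time integral at `0` of a function satisfying the exponential bound
  have hI : ∀ F : ℝ → ℝ, ContinuousOn F (Ici 0) → (∀ s, 0 ≤ s → 0 ≤ F s) →
      (∀ s, 0 ≤ s → F s ≤ C * Real.exp (K * s)) → ∀ s ∈ Icc 0 t,
      0 ≤ ∫ r in (0 : ℝ)..s, F r ∧ ∫ r in (0 : ℝ)..s, F r ≤ t * (C * Real.exp (K * t)) := by
    intro F hF hF0 hFC s hs
    refine ⟨intervalIntegral.integral_nonneg hs.1 fun r hr => hF0 r hr.1, ?_⟩
    have hi : IntervalIntegrable F volume 0 s :=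
      (hF.mono (by rw [uIcc_of_le hs.1]; exact Icc_subset_Ici_self)).intervalIntegrable
    calc ∫ r in (0 : ℝ)..s, F r ≤ ∫ r in (0 : ℝ)..s, C * Real.exp (K * t) := by
          refine intervalIntegral.integral_mono_on hs.1 hi intervalIntegrable_const fun r hr => ?_
          refine (hFC r hr.1).trans ?_
          have := hr.2.trans hs.2
          gcongr
      _ = s * (C * Real.exp (K * t)) := by
          rw [intervalIntegral.integral_const, sub_zero, smul_eq_mul]
      _ ≤ _ := by have := hs.2; gcongr
  have hint_cont : ∀ F : ℝ → ℝ, ContinuousOn F (Ici 0) →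
      ContinuousOn (fun t => ∫ s in (0 : ℝ)..t, F s) (Ici 0) := fun F hF =>
    continuousOn_primitive_Ici fun T hT =>
      (hF.mono (by rw [uIcc_of_le hT]; exact Icc_subset_Ici_self)).intervalIntegrable
  have hHcont : ∀ k x, Continuous fun t => H k t x := fun k x => continuous_picard k x
  -- the truncated sums are bounded subsolutions
  have hsub : ∀ k x s, s ∈ Icc 0 t → lam 0 * u 0 * (∫ r in (0 : ℝ)..s, H (k + 1) r 0) +
      ∑ z ∈ Finset.range x, u z * H (k + 1) s z ≤ p s x := by
    intro k x s hs
    rw [← sub_nonneg]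
    refine nonneg_of_supersolution hlam hnu hone (T := t)
      (r := fun s x => p s x - (lam 0 * u 0 * (∫ r in (0 : ℝ)..s, H (k + 1) r 0) +
        ∑ z ∈ Finset.range x, u z * H (k + 1) s z))
      (r' := fun s x => (-(lam x + nu x) * p s x + (lam x * p s (x + 1) + nu x * p s (x - 1))) -
        (lam 0 * u 0 * H (k + 1) s 0 + ∑ z ∈ Finset.range x, u z *
          (-(lam z + nu (z + 1)) * H (k + 1) s z +
            (modBirth lam u z * H k s (z + 1) + modDeath nu u z * H k s (z - 1)))))
      (C := lam 0 * u 0 * (t * (C * Real.exp (K * t))) +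
        ∑ z ∈ Finset.range (Y + (k + 1)), u z * (C * Real.exp (K * t))) ?_ ?_ ?_ ?_ ?_ hs x
    · intro s hs x
      have h1 := (hI _ (hHcont (k + 1) 0).continuousOn (fun s hs => hH0 _ _ s hs)
        (fun s hs => hHC _ _ s hs) s hs).2
      have h2 : ∑ z ∈ Finset.range x, u z * H (k + 1) s z ≤
          ∑ z ∈ Finset.range (Y + (k + 1)), u z * (C * Real.exp (K * t)) := by
        calc ∑ z ∈ Finset.range x, u z * H (k + 1) s z
            ≤ ∑ z ∈ Finset.range (Y + (k + 1)), u z * H (k + 1) s z :=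
              sum_range_le_of_support hu (fun z => hH0 _ z s hs.1)
                (fun z hz => picard_eq_zero_of_le hgY (k + 1) z s hz) x
          _ ≤ _ := by
              refine Finset.sum_le_sum fun z _ => mul_le_mul_of_nonneg_left ?_ (hu z).le
              refine (hHC _ _ s hs.1).trans ?_
              have := hs.2
              gcongr
      have h3 := hp0 x s hs.1
      have h4 := mul_le_mul_of_nonneg_left h1 hlu
      linarith
    · intro x
      refine (hsolp x).1.sub (ContinuousOn.add (continuousOn_const.mul
        (hint_cont _ (hHcont (k + 1) 0).continuousOn)) ?_)
      exact continuousOn_finsetSum _ fun z _ => continuousOn_const.mul (hHcont (k + 1) z).continuousOn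
    · intro x s hs
      refine ((hsolp x).2 s hs).sub (HasDerivAt.add
        (((hHcont (k + 1) 0).integral_hasStrictDerivAt 0 s).hasDerivAt.const_mul _) ?_)
      exact HasDerivAt.fun_sum fun z _ => (hasDerivAt_picard_succ k z s).const_mul _
    · intro x s hs
      have h1 := generator_sum (lam := lam) hirr.death_zero hu (fun z => H (k + 1) s z)
        (lam 0 * u 0 * (∫ r in (0 : ℝ)..s, H (k + 1) r 0)) x
      -- The time derivative of iterate `k + 1` involves iterate `k` at the neighbours. Since the
      -- iterates increase, replacing `k` by `k + 1` there only enlarges it, so the sum is a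
      -- subsolution.
      have h2 : ∑ z ∈ Finset.range x, u z * (-(lam z + nu (z + 1)) * H (k + 1) s z +
            (modBirth lam u z * H k s (z + 1) + modDeath nu u z * H k s (z - 1))) ≤
          ∑ z ∈ Finset.range x, u z * (-(lam z + nu (z + 1)) * H (k + 1) s z +
            (modBirth lam u z * H (k + 1) s (z + 1) + modDeath nu u z * H (k + 1) s (z - 1))) := by
        have hm : ∀ z, H k s z ≤ H (k + 1) s z := fun z => picard_le_succ hb hd hg k z hs.le
        refine Finset.sum_le_sum fun z _ => mul_le_mul_of_nonneg_left ?_ (hu z).le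
        have h3 := mul_le_mul_of_nonneg_left (hm (z + 1)) (hb z)
        have h4 := mul_le_mul_of_nonneg_left (hm (z - 1)) (hd z)
        linarith
      linarith
    · intro x
      simp [hp_zero, H, hf]
  -- The bound no longer depends on `k` or `x`: the nonnegative time integral is dropped and `p ≤ f
  -- Y` is used.
  have hsum_le : ∀ x s, s ∈ Icc 0 t → ∑ z ∈ Finset.range x, u z * h s z ≤ f Y := by
    intro x s hs
    have hl : Tendsto (fun k => ∑ z ∈ Finset.range x, u z * H (k + 1) s z) atTop
        (𝓝 (∑ z ∈ Finset.range x, u z * h s z)) :=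
      tendsto_finsetSum _ fun z _ => ((hh s hs.1 z).comp (tendsto_add_atTop_nat 1)).const_mul _
    refine le_of_tendsto' hl fun k => ?_
    have h1 := hsub k x s hs
    have h2 := (hI _ (hHcont (k + 1) 0).continuousOn (fun s hs => hH0 _ _ s hs)
        (fun s hs => hHC _ _ s hs) s hs).1
    have h3 := hpD x s hs.1
    have h4 := mul_nonneg hlu h2
    linarith
  have hvcont : ∀ x, ContinuousOn (fun s => lam 0 * u 0 * (∫ r in (0 : ℝ)..s, h r 0) +
      ∑ z ∈ Finset.range x, u z * h s z) (Ici 0) := fun x =>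
    (continuousOn_const.mul (hint_cont _ (hsolh 0).1)).add
      (continuousOn_finsetSum _ fun z _ => continuousOn_const.mul (hsolh z).1)
  have hvder : ∀ x s, 0 < s → HasDerivAt (fun s => lam 0 * u 0 * (∫ r in (0 : ℝ)..s, h r 0) +
      ∑ z ∈ Finset.range x, u z * h s z) (lam 0 * u 0 * h s 0 + ∑ z ∈ Finset.range x, u z *
        (-(lam z + nu (z + 1)) * h s z +
          (modBirth lam u z * h s (z + 1) + modDeath nu u z * h s (z - 1)))) s := fun x s hs =>
    ((hasDerivAt_primitive_of_continuousOn_Ici (hsolh 0).1 hs).const_mul _).add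
      (HasDerivAt.fun_sum fun z _ => ((hsolh z).2 s hs).const_mul _)
  have hv0 : ∀ x s, s ∈ Icc 0 t → 0 ≤ lam 0 * u 0 * (∫ r in (0 : ℝ)..s, h r 0) +
      ∑ z ∈ Finset.range x, u z * h s z := fun x s hs =>
    add_nonneg (mul_nonneg hlu (hI _ (hsolh 0).1 (hh0 0) (hhC 0) s hs).1)
      (Finset.sum_nonneg fun z _ => mul_nonneg (hu z).le (hh0 z s hs.1))
  refine le_antisymm ?_ ?_ <;> rw [← sub_nonneg]
  · refine nonneg_of_supersolution hlam hnu hone (T := t) (C := f Y)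
      (r := fun s x => lam 0 * u 0 * (∫ r in (0 : ℝ)..s, h r 0) +
        ∑ z ∈ Finset.range x, u z * h s z - p s x) (fun s hs x => ?_)
      (fun x => (hvcont x).sub (hsolp x).1)
      (fun x s hs => (hvder x s hs).sub ((hsolp x).2 s hs)) (fun x s hs => ?_) (fun x => ?_)
      ⟨ht, le_rfl⟩ x
    · have := hv0 x s hs
      have := hpD x s hs.1
      linarith
    · have := generator_sum (lam := lam) hirr.death_zero hu (fun z => h s z)
        (lam 0 * u 0 * (∫ r in (0 : ℝ)..s, h r 0)) x
      linarith
    · simp [hp_zero, hh_zero, hf]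
  · refine nonneg_of_supersolution hlam hnu hone (T := t)
      (C := lam 0 * u 0 * (t * (C * Real.exp (K * t))) + f Y)
      (r := fun s x => p s x - (lam 0 * u 0 * (∫ r in (0 : ℝ)..s, h r 0) +
        ∑ z ∈ Finset.range x, u z * h s z)) (fun s hs x => ?_)
      (fun x => (hsolp x).1.sub (hvcont x))
      (fun x s hs => ((hsolp x).2 s hs).sub (hvder x s hs)) (fun x s hs => ?_) (fun x => ?_)
      ⟨ht, le_rfl⟩ x
    · have h1 := hsum_le x s hs
      have h2 := mul_le_mul_of_nonneg_left (hI _ (hsolh 0).1 (hh0 0) (hhC 0) s hs).2 hlu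
      have h3 := hp0 x s hs.1
      linarith
    · have := generator_sum (lam := lam) hirr.death_zero hu (fun z => h s z)
        (lam 0 * u 0 * (∫ r in (0 : ℝ)..s, h r 0)) x
      linarith
    · simp [hp_zero, hh_zero, hf]

/-! ### Splitting off the first pair of the noise -/

/-- The noise after the first pair. -/
def tail (ω : Noise) : Noise := fun n => ω (n + 1)

/-- The noise with first pair `p.1`, followed by `p.2`. -/
def cons (p : (ℝ × unitInterval) × Noise) : Noise
  | 0 => p.1
  | n + 1 => p.2 n

theorem measurable_tail : Measurable tail := measurable_pi_lambda _ fun n => measurable_pi_apply (n + 1)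

theorem measurable_cons : Measurable cons :=
  measurable_pi_lambda _ fun n => by
    rcases n with _ | n
    · exact measurable_fst
    · exact (measurable_pi_apply n).comp measurable_snd

/-- This is the renewal structure of an i.i.d. sequence, checked on cylinders; it yields the Markov
property at the first jump. -/
theorem map_cons_noise :
    (((expMeasure 1).prod (volume : Measure unitInterval)).prod noise).map cons = noise := by
  classical
  refine Measure.eq_infinitePi _ fun s t ht => ?_
  -- Filling the missing coordinates with `univ` turns `s` into an initial segment, where the zeroth
  -- factor can be split off.
  set t' : ℕ → Set (ℝ × unitInterval) := fun i => if i ∈ s then t i else univ with ht'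
  have hm : ∀ i, MeasurableSet (t' i) := fun i => by
    simp only [ht']
    split_ifs
    exacts [ht i, MeasurableSet.univ]
  obtain ⟨N, hN⟩ : ∃ N, s ⊆ Finset.range (N + 1) :=
    ⟨s.sup id, fun i hi => Finset.mem_range.2 (Nat.lt_succ_of_le (Finset.le_sup (f := id) hi))⟩
  have hpre : cons ⁻¹' (Set.pi s t) = t' 0 ×ˢ Set.pi (Finset.range N) (fun i => t' (i + 1)) := by
    ext p
    simp only [mem_preimage, Set.mem_pi, mem_prod, ht']
    constructor
    · intro h
      refine ⟨?_, fun i _ => ?_⟩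
      · split_ifs with h0
        exacts [h 0 h0, trivial]
      · split_ifs with h0
        exacts [h (i + 1) h0, trivial]
    · rintro ⟨h0, h1⟩ i hi
      rcases i with _ | i
      · have hi' : 0 ∈ s := hi
        change p.1 ∈ t 0
        simpa [hi'] using h0
      · have hi' : i + 1 ∈ s := hi
        have := h1 i (by simpa using hN hi')
        change p.2 i ∈ t (i + 1)
        simpa [hi'] using this
  rw [Measure.map_apply measurable_cons (MeasurableSet.pi s.countable_toSet fun i _ => ht i), hpre,
    Measure.prod_prod]
  conv_lhs => rw [noise, Measure.infinitePi_pi _ (fun i _ => hm (i + 1)), mul_comm]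
  rw [← Finset.prod_range_succ'
    (fun i => ((expMeasure 1).prod (volume : Measure unitInterval)) (t' i)) N,
    ← Finset.prod_subset hN fun i _ hi => by simp [ht', hi]]
  exact Finset.prod_congr rfl fun i hi => by simp [ht', hi]

theorem lintegral_noise {Φ : (ℝ × unitInterval) → Noise → ENNReal}
    (hΦ : Measurable (Function.uncurry Φ)) :
    ∫⁻ ω, Φ (ω 0) (tail ω) ∂noise =
      ∫⁻ e, ∫⁻ U, ∫⁻ ω, Φ (e, U) ω ∂noise ∂(volume : Measure unitInterval) ∂(expMeasure 1) := by
  have hm : Measurable fun ω : Noise => Φ (ω 0) (tail ω) :=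
    hΦ.comp ((measurable_pi_apply 0).prodMk measurable_tail)
  conv_lhs => rw [← map_cons_noise]
  rw [lintegral_map hm measurable_cons]
  change ∫⁻ p, Function.uncurry Φ p ∂_ = _
  rw [lintegral_prod _ hΦ.aemeasurable, lintegral_prod _ hΦ.lintegral_prod_right'.aemeasurable]
  rfl

theorem lintegral_expMeasure_one {φ : ℝ → ENNReal} (hφ : Measurable φ) :
    ∫⁻ e, φ e ∂(expMeasure 1) = ∫⁻ e in Ioi 0, ENNReal.ofReal (Real.exp (-e)) * φ e := by
  have h1 : expMeasure 1 = volume.withDensity (exponentialPDF 1) := rfl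
  have h2 : Measurable (exponentialPDF 1) := (measurable_exponentialPDFReal 1).ennreal_ofReal
  rw [h1, lintegral_withDensity_eq_lintegral_mul _ h2 hφ,
    ← setLIntegral_congr Ioi_ae_eq_Ici.symm, ← lintegral_indicator measurableSet_Ici]
  refine lintegral_congr fun e => ?_
  by_cases he : 0 ≤ e <;> simp [exponentialPDF_eq, indicator, he]

theorem ae_noise_nonneg : ∀ᵐ ω ∂noise, ∀ n, 0 ≤ (ω n).1 := by
  refine ae_all_iff.2 fun n => ?_
  have h1 : ∀ᵐ e ∂(expMeasure 1), 0 ≤ e := by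
    have : expMeasure 1 = volume.withDensity (exponentialPDF 1) := rfl
    rw [ae_iff, this, withDensity_apply _ (by measurability)]
    rw [setLIntegral_congr_fun (g := fun _ => 0) (by measurability)
      (fun x hx => exponentialPDF_of_neg (by simpa using hx))]
    simp
  have h2 : ∀ᵐ p ∂((expMeasure 1).prod (volume : Measure unitInterval)), 0 ≤ p.1 :=
    Measure.quasiMeasurePreserving_fst.ae h1
  exact (measurePreserving_eval_infinitePi
    (fun _ : ℕ => (expMeasure 1).prod (volume : Measure unitInterval)) n).quasiMeasurePreserving.ae h2

/-! ### The first jump -/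

section FirstJump

variable (b d : ℕ → ℝ)

/-- The state after the first jump from `x`. -/
noncomputable def firstState (x : ℕ) (ω : Noise) : ℕ :=
  if ((ω 0).2 : ℝ) ≤ b x / (b x + d x) then x + 1 else x - 1

/-- The time of the first jump from `x`. -/
noncomputable def firstTime (x : ℕ) (ω : Noise) : ℝ := (ω 0).1 / (b x + d x)

theorem chain_succ (x : ℕ) (ω : Noise) (n : ℕ) :
    chain b d x ω (n + 1) = chain b d (firstState b d x ω) (tail ω) n := by
  induction n with
  | zero => rfl
  | succ n ih =>
    rw [chain, ih]
    rfl

theorem jumpTime_succ (x : ℕ) (ω : Noise) (n : ℕ) :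
    jumpTime b d x ω (n + 1) = firstTime b d x ω + jumpTime b d (firstState b d x ω) (tail ω) n := by
  rw [jumpTime, Finset.sum_range_succ', add_comm]
  congr 1
  refine Finset.sum_congr rfl fun k _ => ?_
  rw [holdingTime, chain_succ]
  rfl

theorem jumpTime_one (x : ℕ) (ω : Noise) : jumpTime b d x ω 1 = firstTime b d x ω := by
  rw [jumpTime_succ, jumpTime, Finset.sum_range_zero, add_zero]

variable {b d}

theorem process_of_lt {x : ℕ} {t : ℝ} {ω : Noise} (h : t < firstTime b d x ω) :
    process b d x t ω = some x := by
  have h0 : t < jumpTime b d x ω (0 + 1) := by simpa [jumpTime_one] using h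
  have hex : ∃ n, t < jumpTime b d x ω (n + 1) := ⟨0, h0⟩
  rw [process, dif_pos hex, (Nat.find_eq_zero hex).2 h0]
  rfl

/-- After its first jump the path restarts from the new state with the shifted noise; the `Nat.find`
of the restarted path is one less. This also covers explosion. -/
theorem process_of_le {x : ℕ} {t : ℝ} {ω : Noise} (h : firstTime b d x ω ≤ t) :
    process b d x t ω =
      process b d (firstState b d x ω) (t - firstTime b d x ω) (tail ω) := by
  classical
  have h0 : ¬ t < jumpTime b d x ω (0 + 1) := by simpa [jumpTime_one] using h
  have hiff : ∀ n, t < jumpTime b d x ω (n + 1 + 1) ↔ t - firstTime b d x ω <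
      jumpTime b d (firstState b d x ω) (tail ω) (n + 1) := fun n => by
    rw [jumpTime_succ, sub_lt_iff_lt_add']
  by_cases hex : ∃ n, t < jumpTime b d x ω (n + 1)
  · have hex1 : ∃ n, t < jumpTime b d x ω (n + 1 + 1) := by
      obtain ⟨n, hn⟩ := hex
      rcases n with _ | n
      exacts [absurd hn h0, ⟨n, hn⟩]
    have hex2 : ∃ n, t - firstTime b d x ω <
        jumpTime b d (firstState b d x ω) (tail ω) (n + 1) := by simpa only [hiff] using hex1
    rw [process, process, dif_pos hex, dif_pos hex2, Nat.find_comp_succ hex hex1 h0, chain_succ]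
    congr 2
    exact Nat.find_congr' (fun {n} => hiff n)
  · have hex2 : ¬ ∃ n, t - firstTime b d x ω <
        jumpTime b d (firstState b d x ω) (tail ω) (n + 1) := fun ⟨n, hn⟩ =>
      hex ⟨n + 1, (hiff n).2 hn⟩
    rw [process, process, dif_neg hex, dif_neg hex2]

end FirstJump

/-! ### Feynman-Kac weights of paths with a bounded number of jumps -/

/-- The Feynman-Kac weight restricted to the paths with less than `k` jumps by time `t`, defined by
recursion at the first jump. -/
noncomputable def truncWeight (b d V g : ℕ → ℝ) : ℕ → ℕ → ℝ → Noise → ℝ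
  | 0, _, _, _ => 0
  | k + 1, x, t, ω =>
    if t < (ω 0).1 / (b x + d x) then g x * Real.exp (-(V x * t))
    else Real.exp (-(V x * ((ω 0).1 / (b x + d x)))) *
      if ((ω 0).2 : ℝ) ≤ b x / (b x + d x) then
        truncWeight b d V g k (x + 1) (t - (ω 0).1 / (b x + d x)) (tail ω)
      else truncWeight b d V g k (x - 1) (t - (ω 0).1 / (b x + d x)) (tail ω)

section TruncWeight

variable {b d V g : ℕ → ℝ}

theorem truncWeight_succ (k x : ℕ) (t : ℝ) (ω : Noise) : truncWeight b d V g (k + 1) x t ω =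
    if t < firstTime b d x ω then g x * Real.exp (-(V x * t))
    else Real.exp (-(V x * firstTime b d x ω)) *
      truncWeight b d V g k (firstState b d x ω) (t - firstTime b d x ω) (tail ω) := by
  rw [truncWeight, firstTime, firstState]
  split_ifs <;> rfl

theorem measurable_truncWeight (k x : ℕ) :
    Measurable fun p : ℝ × Noise => truncWeight b d V g k x p.1 p.2 := by
  induction k generalizing x with
  | zero => exact measurable_const
  | succ k ih =>
    have h0 : Measurable fun p : ℝ × Noise => (p.2 0).1 / (b x + d x) :=
      (measurable_fst.comp ((measurable_pi_apply 0).comp measurable_snd)).div_const _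
    have h1 : Measurable fun p : ℝ × Noise => ((p.2 0).2 : ℝ) :=
      measurable_subtype_coe.comp
        (measurable_snd.comp ((measurable_pi_apply 0).comp measurable_snd))
    have h2 : Measurable fun p : ℝ × Noise => (p.1 - (p.2 0).1 / (b x + d x), tail p.2) :=
      (measurable_fst.sub h0).prodMk (measurable_tail.comp measurable_snd)
    simp only [truncWeight]
    refine Measurable.ite (measurableSet_lt measurable_fst h0) ?_ (Measurable.mul ?_ ?_)
    · fun_prop
    · fun_prop
    · exact Measurable.ite (measurableSet_le h1 measurable_const) ((ih (x + 1)).comp h2)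
        ((ih (x - 1)).comp h2)

theorem truncWeight_nonneg (hg : ∀ x, 0 ≤ g x) (k x : ℕ) (t : ℝ) (ω : Noise) :
    0 ≤ truncWeight b d V g k x t ω := by
  induction k generalizing x t ω with
  | zero => exact le_rfl
  | succ k ih =>
    rw [truncWeight_succ]
    split_ifs
    · exact mul_nonneg (hg x) (Real.exp_pos _).le
    · exact mul_nonneg (Real.exp_pos _).le (ih _ _ _)

theorem monotone_truncWeight (hg : ∀ x, 0 ≤ g x) (x : ℕ) (t : ℝ) (ω : Noise) :
    Monotone fun k => truncWeight b d V g k x t ω := by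
  refine monotone_nat_of_le_succ fun k => ?_
  induction k generalizing x t ω with
  | zero => exact truncWeight_nonneg hg _ _ _ _
  | succ k ih =>
    rw [truncWeight_succ, truncWeight_succ (k + 1)]
    split_ifs
    · exact le_rfl
    · exact mul_le_mul_of_nonneg_left (ih _ _ _) (Real.exp_pos _).le

theorem integral_process_of_lt {x : ℕ} {t : ℝ} (ht : 0 ≤ t) {ω : Noise}
    (h : t ≤ firstTime b d x ω) :
    IntervalIntegrable (fun s => ext V (process b d x s ω)) volume 0 t ∧
      ∫ s in (0 : ℝ)..t, ext V (process b d x s ω) = V x * t := by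
  have heq : EqOn (fun _ => V x) (fun s => ext V (process b d x s ω)) (uIoo 0 t) := fun s hs => by
    rw [uIoo_of_le ht] at hs
    simp only [process_of_lt (hs.2.trans_le h), ext]
  refine ⟨intervalIntegrable_const.congr_uIoo heq, ?_⟩
  rw [← intervalIntegral.integral_congr_uIoo heq, intervalIntegral.integral_const, sub_zero, smul_eq_mul,
    mul_comm]

theorem integral_process_of_le {x : ℕ} {t : ℝ} {ω : Noise} (h0 : 0 ≤ firstTime b d x ω)
    (h : firstTime b d x ω ≤ t)
    (hi : IntervalIntegrable (fun s => ext V (process b d (firstState b d x ω) s (tail ω))) volume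
      0 (t - firstTime b d x ω)) :
    IntervalIntegrable (fun s => ext V (process b d x s ω)) volume 0 t ∧
      ∫ s in (0 : ℝ)..t, ext V (process b d x s ω) = V x * firstTime b d x ω +
        ∫ s in (0 : ℝ)..(t - firstTime b d x ω),
          ext V (process b d (firstState b d x ω) s (tail ω)) := by
  obtain ⟨hi1, hint1⟩ := integral_process_of_lt (V := V) h0 le_rfl
  have heq : EqOn (fun s => ext V (process b d (firstState b d x ω) (s - firstTime b d x ω) (tail ω)))
      (fun s => ext V (process b d x s ω)) (uIcc (firstTime b d x ω) t) := fun s hs => by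
    rw [uIcc_of_le h] at hs
    simp only [process_of_le hs.1]
  have hi2 : IntervalIntegrable (fun s => ext V (process b d x s ω)) volume (firstTime b d x ω) t := by
    have := hi.comp_sub_right (firstTime b d x ω)
    rw [zero_add, sub_add_cancel] at this
    exact this.congr (heq.mono uIoc_subset_uIcc)
  refine ⟨hi1.trans hi2, ?_⟩
  rw [← intervalIntegral.integral_add_adjacent_intervals hi1 hi2, hint1,
    ← intervalIntegral.integral_congr heq,
    intervalIntegral.integral_comp_sub_right
      (fun s => ext V (process b d (firstState b d x ω) s (tail ω))), sub_self]

/-- Integrability is carried through the induction because splitting the integral of `V` at the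
first jump needs it; it holds since only finitely many jumps occur by time `t`. -/
theorem truncWeight_eq (hq : ∀ x, 0 < b x + d x) (k x : ℕ) {t : ℝ} (ht : 0 ≤ t) {ω : Noise}
    (hω : ∀ n, 0 ≤ (ω n).1) :
    ((∃ m < k, t < jumpTime b d x ω (m + 1)) →
      IntervalIntegrable (fun s => ext V (process b d x s ω)) volume 0 t ∧
        truncWeight b d V g k x t ω = feynmanKacWeight b d V t g x ω) ∧
    ((¬ ∃ m < k, t < jumpTime b d x ω (m + 1)) → truncWeight b d V g k x t ω = 0) := by
  induction k generalizing x t ω with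
  | zero => exact ⟨fun ⟨m, hm, _⟩ => absurd hm (Nat.not_lt_zero m), fun _ => rfl⟩
  | succ k ih =>
    have hσ : 0 ≤ firstTime b d x ω := div_nonneg (hω 0) (hq x).le
    rw [truncWeight_succ]
    by_cases hlt : t < firstTime b d x ω
    · obtain ⟨hi, hint⟩ := integral_process_of_lt (V := V) ht hlt.le
      rw [if_pos hlt]
      refine ⟨fun _ => ⟨hi, ?_⟩, fun hn => absurd ⟨0, k.succ_pos, ?_⟩ hn⟩
      · rw [feynmanKacWeight, hint, process_of_lt hlt, ext]
      · simpa [jumpTime_one] using hlt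
    · rw [if_neg hlt]
      have hle := not_lt.1 hlt
      have hiff : (∃ m < k + 1, t < jumpTime b d x ω (m + 1)) ↔
          ∃ m < k, t - firstTime b d x ω <
            jumpTime b d (firstState b d x ω) (tail ω) (m + 1) := by
        constructor
        · rintro ⟨m, hm, h⟩
          rcases m with _ | m
          · exact absurd (by simpa [jumpTime_one] using h) hlt
          · exact ⟨m, by omega, by rwa [jumpTime_succ, ← sub_lt_iff_lt_add'] at h⟩
        · rintro ⟨m, hm, h⟩
          exact ⟨m + 1, by omega, by rwa [jumpTime_succ, ← sub_lt_iff_lt_add']⟩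
      obtain ⟨h1, h2⟩ := ih (firstState b d x ω) (sub_nonneg.2 hle) (ω := tail ω)
        (fun n => hω (n + 1))
      rw [hiff]
      refine ⟨fun h => ?_, fun h => by rw [h2 h, mul_zero]⟩
      obtain ⟨hi, hw⟩ := h1 h
      obtain ⟨hi', hint⟩ := integral_process_of_le hσ hle hi
      refine ⟨hi', ?_⟩
      rw [hw, feynmanKacWeight, feynmanKacWeight, hint, process_of_le hle, neg_add, Real.exp_add]
      ring

theorem tendsto_truncWeight (hq : ∀ x, 0 < b x + d x) (x : ℕ) {t : ℝ} (ht : 0 ≤ t) {ω : Noise}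
    (hω : ∀ n, 0 ≤ (ω n).1) :
    Tendsto (fun k => truncWeight b d V g k x t ω) atTop (𝓝 (feynmanKacWeight b d V t g x ω)) := by
  by_cases hex : ∃ m, t < jumpTime b d x ω (m + 1)
  · obtain ⟨m, hm⟩ := hex
    refine tendsto_const_nhds.congr' ?_
    filter_upwards [eventually_gt_atTop m] with k hk
    exact (((truncWeight_eq hq k x ht hω).1 ⟨m, hk, hm⟩).2).symm
  · have h0 : feynmanKacWeight b d V t g x ω = 0 := by
      rw [feynmanKacWeight, process, dif_neg hex, ext, zero_mul]
    rw [h0]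
    refine tendsto_const_nhds.congr fun k => ?_
    exact ((truncWeight_eq hq k x ht hω).2 fun ⟨m, _, hm⟩ => hex ⟨m, hm⟩).symm

theorem aestronglyMeasurable_feynmanKacWeight (hq : ∀ x, 0 < b x + d x) (x : ℕ) {t : ℝ}
    (ht : 0 ≤ t) : AEStronglyMeasurable (feynmanKacWeight b d V t g x) noise := by
  refine aestronglyMeasurable_of_tendsto_ae atTop (f := fun k => truncWeight b d V g k x t)
    (fun k => ?_) ?_
  · exact ((measurable_truncWeight k x).comp measurable_prodMk_left).aestronglyMeasurable
  · filter_upwards [ae_noise_nonneg] with ω hω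
    exact tendsto_truncWeight hq x ht hω

/-! ### Expectations of the truncated weights -/

theorem lintegral_step {a : ℝ} (ha : a ∈ Icc (0 : ℝ) 1) {p q : ℝ} (hp : 0 ≤ p) (hq : 0 ≤ q) :
    ∫⁻ U : unitInterval, ENNReal.ofReal (if (U : ℝ) ≤ a then p else q) =
      ENNReal.ofReal (a * p + (1 - a) * q) := by
  have hs : MeasurableSet (Iic (⟨a, ha⟩ : unitInterval)) := measurableSet_Iic
  have h1 : ∀ U : unitInterval, ENNReal.ofReal (if (U : ℝ) ≤ a then p else q) =
      (Iic (⟨a, ha⟩ : unitInterval)).piecewise (fun _ => ENNReal.ofReal p)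
        (fun _ => ENNReal.ofReal q) U := fun U => by
    by_cases hU : (U : ℝ) ≤ a
    · rw [if_pos hU, piecewise_eq_of_mem _ _ _ (by exact hU)]
    · rw [if_neg hU, piecewise_eq_of_notMem _ _ _ (by exact hU)]
  simp only [h1]
  rw [lintegral_piecewise hs, setLIntegral_const, setLIntegral_const, compl_Iic,
    unitInterval.volume_Iic, unitInterval.volume_Ioi, mul_comm, mul_comm (ENNReal.ofReal q),
    ENNReal.ofReal_add (mul_nonneg ha.1 hp) (mul_nonneg (sub_nonneg.2 ha.2) hq),
    ENNReal.ofReal_mul ha.1, ENNReal.ofReal_mul (sub_nonneg.2 ha.2)]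

/-- Expectation at an exponential time of parameter `q`, killed at time `t`. -/
theorem lintegral_exp_time {q t A : ℝ} (hq : 0 < q) (ht : 0 ≤ t) (hA : 0 ≤ A) {F : ℝ → ℝ}
    (hF : Continuous F) (hF0 : ∀ s ∈ Icc 0 t, 0 ≤ F s) :
    ∫⁻ e, ENNReal.ofReal (if t < e / q then A else F (e / q)) ∂(expMeasure 1) =
      ENNReal.ofReal (Real.exp (-(q * t)) * A +
        q * ∫ s in (0 : ℝ)..t, Real.exp (-(q * s)) * F s) := by
  have hqt : 0 ≤ q * t := mul_nonneg hq.le ht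
  have hm : Measurable fun e => ENNReal.ofReal (if t < e / q then A else F (e / q)) :=
    (Measurable.ite (measurableSet_lt measurable_const (by fun_prop)) measurable_const
      (hF.measurable.comp (by fun_prop))).ennreal_ofReal
  rw [lintegral_expMeasure_one hm, ← Ioc_union_Ioi_eq_Ioi hqt,
    lintegral_union measurableSet_Ioi (Ioc_disjoint_Ioi le_rfl)]
  have h1 : ∫⁻ e in Ioc 0 (q * t), ENNReal.ofReal (Real.exp (-e)) *
      ENNReal.ofReal (if t < e / q then A else F (e / q)) =
      ENNReal.ofReal (q * ∫ s in (0 : ℝ)..t, Real.exp (-(q * s)) * F s) := by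
    have hc : Continuous fun e => Real.exp (-e) * F (e / q) := by fun_prop
    have hsub := intervalIntegral.integral_comp_div (a := 0) (b := q * t)
      (fun s => Real.exp (-(q * s)) * F s) hq.ne'
    rw [zero_div, mul_div_cancel_left₀ _ hq.ne', smul_eq_mul] at hsub
    rw [← hsub, intervalIntegral.integral_of_le hqt]
    have hsimp : ∀ e, q * (e / q) = e := fun e => mul_div_cancel₀ e hq.ne'
    simp only [hsimp]
    have hmem : ∀ e ∈ Ioc 0 (q * t), e / q ∈ Icc 0 t := fun e he =>
      ⟨div_nonneg he.1.le hq.le, (div_le_iff₀' hq).2 he.2⟩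
    rw [ofReal_integral_eq_lintegral_ofReal]
    · refine setLIntegral_congr_fun measurableSet_Ioc fun e he => ?_
      rw [if_neg (hmem e he).2.not_gt, ← ENNReal.ofReal_mul (Real.exp_pos _).le]
    · exact (hc.integrableOn_Icc (a := 0) (b := q * t)).mono_set Ioc_subset_Icc_self
    · filter_upwards [ae_restrict_mem measurableSet_Ioc] with e he
      exact mul_nonneg (Real.exp_pos _).le (hF0 _ (hmem e he))
  have h2 : ∫⁻ e in Ioi (q * t), ENNReal.ofReal (Real.exp (-e)) *
      ENNReal.ofReal (if t < e / q then A else F (e / q)) =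
      ENNReal.ofReal (Real.exp (-(q * t)) * A) := by
    rw [ENNReal.ofReal_mul (Real.exp_pos _).le, ← integral_exp_neg_Ioi,
      ofReal_integral_eq_lintegral_ofReal (integrableOn_exp_neg_Ioi _)
        (ae_of_all _ fun e => (Real.exp_pos _).le), ← lintegral_mul_const _ (by fun_prop)]
    refine setLIntegral_congr_fun measurableSet_Ioi fun e he => ?_
    rw [if_pos ((lt_div_iff₀' hq).2 he)]
  rw [h1, h2, add_comm, ENNReal.ofReal_add (mul_nonneg (Real.exp_pos _).le hA)]
  exact mul_nonneg hq.le (intervalIntegral.integral_nonneg ht fun s hs =>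
    mul_nonneg (Real.exp_pos _).le (hF0 s hs))

theorem picard_succ_mild {κ : ℕ → ℝ} (k x : ℕ) (t : ℝ) :
    picard b d κ g (k + 1) t x = Real.exp (-(κ x * t)) * g x + ∫ s in (0 : ℝ)..t,
      Real.exp (-(κ x * s)) * (b x * picard b d κ g k (t - s) (x + 1) +
        d x * picard b d κ g k (t - s) (x - 1)) := by
  have h := intervalIntegral.integral_comp_sub_left (a := 0) (b := t)
    (fun s => Real.exp (κ x * s) *
      (b x * picard b d κ g k s (x + 1) + d x * picard b d κ g k s (x - 1))) t
  rw [sub_self, sub_zero] at h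
  rw [picard_succ, ← h, mul_add, ← intervalIntegral.integral_const_mul]
  congr 1
  refine intervalIntegral.integral_congr fun s _ => ?_
  rw [← mul_assoc, ← Real.exp_add]
  congr 2
  ring

/-- Conditioning on the first jump turns the recursion of `truncWeight` into the mild form
`picard_succ_mild` of the Picard recursion: holding rate and potential combine into `κ = b + d + V`.
-/
theorem lintegral_truncWeight (hb : ∀ x, 0 ≤ b x) (hd : ∀ x, 0 ≤ d x) (hq : ∀ x, 0 < b x + d x)
    (hg : ∀ x, 0 ≤ g x) (k x : ℕ) {t : ℝ} (ht : 0 ≤ t) :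
    ∫⁻ ω, ENNReal.ofReal (truncWeight b d V g k x t ω) ∂noise =
      ENNReal.ofReal (picard b d (fun y => b y + d y + V y) g k t x) := by
  induction k generalizing x t with
  | zero => simp [truncWeight]
  | succ k ih =>
    set S := picard b d (fun y => b y + d y + V y) g with hS
    set q := b x + d x with hqx
    have hqpos : 0 < q := hq x
    have ha : b x / q ∈ Icc (0 : ℝ) 1 :=
      ⟨div_nonneg (hb x) hqpos.le, (div_le_one hqpos).2 (by have := hd x; linarith)⟩
    have ha' : 1 - b x / q = d x / q := by field_simp; rw [hqx]; ring
    have hS0 : ∀ y s, 0 ≤ s → 0 ≤ S k s y := fun y s hs => picard_nonneg hb hd hg k y hs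
    set Φ : (ℝ × unitInterval) → Noise → ENNReal := fun a ω => ENNReal.ofReal
      (if t < a.1 / q then g x * Real.exp (-(V x * t))
        else Real.exp (-(V x * (a.1 / q))) *
          if (a.2 : ℝ) ≤ b x / q then truncWeight b d V g k (x + 1) (t - a.1 / q) ω
          else truncWeight b d V g k (x - 1) (t - a.1 / q) ω) with hΦ
    have hΦm : Measurable (Function.uncurry Φ) := by
      have h0 : Measurable fun p : (ℝ × unitInterval) × Noise => p.1.1 / q :=
        (measurable_fst.comp measurable_fst).div_const _
      have h1 : Measurable fun p : (ℝ × unitInterval) × Noise => (p.1.2 : ℝ) :=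
        measurable_subtype_coe.comp (measurable_snd.comp measurable_fst)
      have h2 : Measurable fun p : (ℝ × unitInterval) × Noise => (t - p.1.1 / q, p.2) :=
        (measurable_const.sub h0).prodMk measurable_snd
      refine (Measurable.ite (measurableSet_lt measurable_const h0) measurable_const
        (Measurable.mul (by fun_prop) ?_)).ennreal_ofReal
      exact Measurable.ite (measurableSet_le h1 measurable_const)
        ((measurable_truncWeight k (x + 1)).comp h2) ((measurable_truncWeight k (x - 1)).comp h2)
    have hstart : ∫⁻ ω, ENNReal.ofReal (truncWeight b d V g (k + 1) x t ω) ∂noise =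
        ∫⁻ ω, Φ (ω 0) (tail ω) ∂noise := rfl
    set F : ℝ → ℝ := fun s => Real.exp (-(V x * s)) *
      (b x / q * S k (t - s) (x + 1) + d x / q * S k (t - s) (x - 1)) with hF
    have hFc : Continuous F := by
      have h1 : ∀ y, Continuous fun s => S k (t - s) y := fun y =>
        (continuous_picard k y).comp (by fun_prop)
      exact Continuous.mul (by fun_prop)
        ((continuous_const.mul (h1 (x + 1))).add (continuous_const.mul (h1 (x - 1))))
    have hF0 : ∀ s ∈ Icc 0 t, 0 ≤ F s := fun s hs => by
      have h1 := hS0 (x + 1) (t - s) (sub_nonneg.2 hs.2)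
      have h2 := hS0 (x - 1) (t - s) (sub_nonneg.2 hs.2)
      have h3 := hb x
      have h4 := hd x
      simp only [hF]
      positivity
    have hinner : ∀ e, ∫⁻ U, ∫⁻ ω, Φ (e, U) ω ∂noise ∂(volume : Measure unitInterval) =
        ENNReal.ofReal (if t < e / q then g x * Real.exp (-(V x * t)) else F (e / q)) := by
      intro e
      by_cases he : t < e / q
      · simp [hΦ, he]
      · have hts : 0 ≤ t - e / q := sub_nonneg.2 (not_lt.1 he)
        have h1 : ∀ U : unitInterval, ∫⁻ ω, Φ (e, U) ω ∂noise =
            ENNReal.ofReal (Real.exp (-(V x * (e / q)))) * ENNReal.ofReal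
              (if (U : ℝ) ≤ b x / q then S k (t - e / q) (x + 1) else S k (t - e / q) (x - 1)) := by
          intro U
          simp only [hΦ, if_neg he, ENNReal.ofReal_mul (Real.exp_pos _).le]
          rw [lintegral_const_mul' _ _ ENNReal.ofReal_ne_top]
          split_ifs
          · rw [ih _ hts]
          · rw [ih _ hts]
        simp only [h1]
        rw [lintegral_const_mul' _ _ ENNReal.ofReal_ne_top, lintegral_step ha (hS0 _ _ hts) (hS0 _ _ hts),
          ← ENNReal.ofReal_mul (Real.exp_pos _).le, if_neg he, ha']
    rw [hstart, lintegral_noise hΦm]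
    simp only [hinner]
    rw [lintegral_exp_time hqpos ht (mul_nonneg (hg x) (Real.exp_pos _).le) hFc hF0,
      hS, picard_succ_mild, ← intervalIntegral.integral_const_mul]
    congr 2
    · rw [mul_comm (g x), ← mul_assoc, ← Real.exp_add]
      congr 2
      ring
    · refine intervalIntegral.integral_congr fun s _ => ?_
      have : Real.exp (-((b x + d x + V x) * s)) = Real.exp (-(q * s)) * Real.exp (-(V x * s)) := by
        rw [← Real.exp_add]
        congr 1
        ring
      simp only [hF, hS, this]
      field_simp

/-- The Feynman-Kac semigroup is the limit of the Picard iterates. -/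
theorem tendsto_picard_feynmanKac (hb : ∀ x, 0 ≤ b x) (hd : ∀ x, 0 ≤ d x)
    (hq : ∀ x, 0 < b x + d x) (hg : ∀ x, 0 ≤ g x) (x : ℕ) {t : ℝ} (ht : 0 ≤ t)
    (hi : Integrable (feynmanKacWeight b d V t g x) noise) :
    Tendsto (fun k => picard b d (fun y => b y + d y + V y) g k t x) atTop
      (𝓝 (feynmanKac b d V t g x)) := by
  have hm : ∀ k, Measurable (truncWeight b d V g k x t) := fun k =>
    (measurable_truncWeight k x).comp measurable_prodMk_left
  have hlin := fun k => lintegral_truncWeight (V := V) hb hd hq hg k x ht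
  have hnn : ∀ k, 0 ≤ᵐ[noise] truncWeight b d V g k x t := fun k =>
    ae_of_all _ fun ω => truncWeight_nonneg hg k x t ω
  have hint : ∀ k, Integrable (truncWeight b d V g k x t) noise := fun k =>
    ⟨(hm k).aestronglyMeasurable, by
      rw [hasFiniteIntegral_iff_ofReal (hnn k), hlin]; exact ENNReal.ofReal_lt_top⟩
  have heq : ∀ k, ∫ ω, truncWeight b d V g k x t ω ∂noise =
      picard b d (fun y => b y + d y + V y) g k t x := fun k => by
    rw [integral_eq_lintegral_of_nonneg_ae (hnn k) (hm k).aestronglyMeasurable, hlin,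
      ENNReal.toReal_ofReal (picard_nonneg hb hd hg k x ht)]
  simp only [← heq]
  refine integral_tendsto_of_tendsto_of_monotone hint hi
    (ae_of_all _ fun ω => monotone_truncWeight hg x t ω) ?_
  filter_upwards [ae_noise_nonneg] with ω hω
  exact tendsto_truncWeight hq x ht hω

end TruncWeight

/-! ### Bounds and integrability of Feynman-Kac weights -/

section Bounds

variable {b d V g : ℕ → ℝ}

theorem abs_ext_le {C : ℝ} (hg : ∀ x, |g x| ≤ C) (o : Option ℕ) : |ext g o| ≤ C := by
  cases o with
  | none => simpa [ext] using (abs_nonneg _).trans (hg 0)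
  | some y => exact hg y

theorem neg_mul_le_integral_process {K t : ℝ} (hK : 0 ≤ K) (hV : ∀ x, -K ≤ V x) (ht : 0 ≤ t) (x : ℕ)
    (ω : Noise) : -(K * t) ≤ ∫ s in (0 : ℝ)..t, ext V (process b d x s ω) := by
  by_cases hi : IntervalIntegrable (fun s => ext V (process b d x s ω)) volume 0 t
  · have h := intervalIntegral.integral_mono_on (f := fun _ => -K) ht intervalIntegrable_const hi
      fun s _ => by
        cases process b d x s ω with
        | none => simpa [ext] using hK
        | some y => exact hV y
    rw [intervalIntegral.integral_const, smul_eq_mul] at h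
    linarith
  -- A non-integrable path has integral `0` by convention, and the bound survives because `K * t ≥
  -- 0`.
  · rw [intervalIntegral.integral_undef hi]
    have := mul_nonneg hK ht
    linarith

theorem abs_feynmanKacWeight_le {C K t : ℝ} (hg : ∀ x, |g x| ≤ C) (hK : 0 ≤ K)
    (hV : ∀ x, -K ≤ V x) (ht : 0 ≤ t) (x : ℕ) (ω : Noise) :
    |feynmanKacWeight b d V t g x ω| ≤ C * Real.exp (K * t) := by
  rw [feynmanKacWeight, abs_mul, abs_of_pos (Real.exp_pos _)]
  have h1 := abs_ext_le hg (process b d x t ω)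
  have h2 := neg_mul_le_integral_process (b := b) (d := d) hK hV ht x ω
  have h3 : 0 ≤ C := (abs_nonneg _).trans h1
  gcongr
  linarith

theorem integrable_feynmanKacWeight {C K t : ℝ} (hq : ∀ x, 0 < b x + d x) (hg : ∀ x, |g x| ≤ C)
    (hK : 0 ≤ K) (hV : ∀ x, -K ≤ V x) (ht : 0 ≤ t) (x : ℕ) :
    Integrable (feynmanKacWeight b d V t g x) noise :=
  Integrable.of_bound (aestronglyMeasurable_feynmanKacWeight hq x ht) (C * Real.exp (K * t))
    (ae_of_all _ fun ω => abs_feynmanKacWeight_le hg hK hV ht x ω)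

theorem abs_feynmanKac_le {C K t : ℝ} (hg : ∀ x, |g x| ≤ C) (hK : 0 ≤ K)
    (hV : ∀ x, -K ≤ V x) (ht : 0 ≤ t) (x : ℕ) :
    |feynmanKac b d V t g x| ≤ C * Real.exp (K * t) := by
  have h := norm_integral_le_of_norm_le_const (μ := noise)
    (f := feynmanKacWeight b d V t g x) (C := C * Real.exp (K * t))
    (ae_of_all _ fun ω => abs_feynmanKacWeight_le (b := b) (d := d) hg hK hV ht x ω)
  rw [probReal_univ, mul_one] at h
  exact h

theorem ext_process_eq_feynmanKacWeight (f : ℕ → ℝ) (t : ℝ) (x : ℕ) (ω : Noise) :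
    ext f (process b d x t ω) = feynmanKacWeight b d (fun _ => 0) t f x ω := by
  have h : ∀ o, ext (fun _ => 0) o = 0 := fun o => by cases o <;> rfl
  simp [feynmanKacWeight, h]

theorem semigroup_eq_feynmanKac (f : ℕ → ℝ) (t : ℝ) (x : ℕ) :
    semigroup b d t f x = feynmanKac b d (fun _ => 0) t f x :=
  integral_congr_ae (ae_of_all _ fun ω => ext_process_eq_feynmanKacWeight f t x ω)

theorem aestronglyMeasurable_ext_process (hq : ∀ x, 0 < b x + d x) (f : ℕ → ℝ) {t : ℝ}
    (ht : 0 ≤ t) (x : ℕ) : AEStronglyMeasurable (fun ω => ext f (process b d x t ω)) noise := by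
  simp only [ext_process_eq_feynmanKacWeight]
  exact aestronglyMeasurable_feynmanKacWeight hq x ht

theorem integrable_ext_process (hq : ∀ x, 0 < b x + d x) {f : ℕ → ℝ} {C : ℝ} (hf : ∀ x, |f x| ≤ C)
    {t : ℝ} (ht : 0 ≤ t) (x : ℕ) : Integrable (fun ω => ext f (process b d x t ω)) noise :=
  Integrable.of_bound (aestronglyMeasurable_ext_process hq f ht x) C
    (ae_of_all _ fun _ => abs_ext_le hf _)

/-- A non-explosive process is alive at every time. -/
theorem semigroup_one (hne : NonExplosive b d) (t : ℝ) (x : ℕ) :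
    semigroup b d t (fun _ => 1) x = 1 := by
  have h : ∀ᵐ ω ∂noise, ext (fun _ => 1) (process b d x t ω) = 1 := by
    filter_upwards [hne x] with ω hω
    have hex : ∃ n, t < jumpTime b d x ω (n + 1) :=
      ((hω.comp (tendsto_add_atTop_nat 1)).eventually_gt_atTop t).exists
    rw [process, dif_pos hex, ext]
  rw [semigroup, integral_congr_ae h]
  simp

/-- The semigroup is the limit of the Picard iterates of its backward equation. -/
theorem tendsto_picard_semigroup (hb : ∀ x, 0 ≤ b x) (hd : ∀ x, 0 ≤ d x)
    (hq : ∀ x, 0 < b x + d x) {f : ℕ → ℝ} (hf : ∀ x, 0 ≤ f x) {C : ℝ} (hfC : ∀ x, f x ≤ C)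
    {t : ℝ} (ht : 0 ≤ t) (x : ℕ) :
    Tendsto (fun k => picard b d (fun y => b y + d y) f k t x) atTop
      (𝓝 (semigroup b d t f x)) := by
  have h := tendsto_picard_feynmanKac (V := fun _ => 0) hb hd hq hf x ht
    (integrable_feynmanKacWeight hq (fun x => by rw [abs_of_nonneg (hf x)]; exact hfC x) le_rfl
      (fun _ => by simp) ht x)
  simpa only [add_zero, ← semigroup_eq_feynmanKac] using h

end Bounds

/-! ### The intertwining relation -/

section Intertwining

variable {lam nu u : ℕ → ℝ}

theorem rate_pos (hirr : IsIrreducible lam nu) (x : ℕ) : 0 < lam x + nu x :=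
  add_pos_of_pos_of_nonneg (hirr.birth_pos x) (hirr.death_nonneg x)

theorem modRate_pos (hirr : IsIrreducible lam nu) (hu : ∀ x, 0 < u x) (x : ℕ) :
    0 < modBirth lam u x + modDeath nu u x :=
  add_pos_of_pos_of_nonneg (modBirth_pos hirr hu x) (modDeath_nonneg hirr hu x)

theorem semigroup_sum_of_finite_support (hirr : IsIrreducible lam nu) (hne : NonExplosive lam nu)
    (hu : ∀ x, 0 < u x) {g : ℕ → ℝ} (hg : ∀ x, 0 ≤ g x) {Y : ℕ} (hgY : ∀ x, Y ≤ x → g x = 0)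
    {C K : ℝ} (hK : 0 ≤ K) (hgC : ∀ x, g x ≤ C) (hV : ∀ x, -K ≤ potential lam nu u x)
    {t : ℝ} (ht : 0 ≤ t) (x : ℕ) :
    semigroup lam nu t (fun x => ∑ z ∈ Finset.range x, u z * g z) x =
      lam 0 * u 0 * (∫ s in (0 : ℝ)..t, feynmanKac (modBirth lam u) (modDeath nu u)
        (potential lam nu u) s g 0) + ∑ z ∈ Finset.range x, u z *
          feynmanKac (modBirth lam u) (modDeath nu u) (potential lam nu u) t g z := by
  have hlam : ∀ x, 0 ≤ lam x := fun x => (hirr.birth_pos x).le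
  -- The potential `V_u` is exactly what makes the modified rates cancel here.
  have hκ : (fun y => modBirth lam u y + modDeath nu u y + potential lam nu u y) =
      fun y => lam y + nu (y + 1) := by
    funext y
    simp only [potential]
    ring
  refine eq_of_tendsto_picard_of_finite_support (h := fun t x => feynmanKac (modBirth lam u)
    (modDeath nu u) (potential lam nu u) t g x) (p := fun t x => semigroup lam nu t
      (fun x => ∑ z ∈ Finset.range x, u z * g z) x) hirr ?_ hu hg hgY hK hgC hV ?_ ?_ ht x
  · intro t ht x
    have := tendsto_picard_semigroup hlam hirr.death_nonneg (rate_pos hirr)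
      (fun _ => zero_le_one) (fun _ => le_rfl) ht x
    rwa [semigroup_one hne] at this
  · intro t ht x
    have := tendsto_picard_feynmanKac (V := potential lam nu u)
      (fun x => (modBirth_pos hirr hu x).le) (modDeath_nonneg hirr hu) (modRate_pos hirr hu) hg x ht
      (integrable_feynmanKacWeight (modRate_pos hirr hu)
        (fun x => by rw [abs_of_nonneg (hg x)]; exact hgC x) hK hV ht x)
    rwa [hκ] at this
  · intro t ht x
    exact tendsto_picard_semigroup hlam hirr.death_nonneg (rate_pos hirr)
      (fun x => Finset.sum_nonneg fun z _ => mul_nonneg (hu z).le (hg z))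
      (sum_range_le_of_support hu hg hgY) ht x

theorem ext_mono {f g : ℕ → ℝ} (h : ∀ x, f x ≤ g x) (o : Option ℕ) : ext f o ≤ ext g o := by
  cases o with
  | none => exact le_rfl
  | some y => exact h y

theorem tendsto_ext {f : ℕ → ℕ → ℝ} {F : ℕ → ℝ} (h : ∀ x, Tendsto (fun n => f n x) atTop (𝓝 (F x)))
    (o : Option ℕ) : Tendsto (fun n => ext (f n) o) atTop (𝓝 (ext F o)) := by
  cases o with
  | none => exact tendsto_const_nhds
  | some y => exact h y

/-- The intertwining relation for a function with bounded nonnegative weighted gradient `g`. -/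
theorem intertwining_of_nonneg (hirr : IsIrreducible lam nu) (hne : NonExplosive lam nu)
    (hu : ∀ x, 0 < u x) {g : ℕ → ℝ} (hg : ∀ x, 0 ≤ g x)
    {C K : ℝ} (hK : 0 ≤ K) (hgC : ∀ x, g x ≤ C) (hV : ∀ x, -K ≤ potential lam nu u x)
    {t : ℝ} (ht : 0 ≤ t) (x : ℕ) :
    Integrable (fun ω => ext (fun x => ∑ z ∈ Finset.range x, u z * g z) (process lam nu x t ω))
      noise ∧
    semigroup lam nu t (fun x => ∑ z ∈ Finset.range x, u z * g z) (x + 1) -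
      semigroup lam nu t (fun x => ∑ z ∈ Finset.range x, u z * g z) x =
      u x * feynmanKac (modBirth lam u) (modDeath nu u) (potential lam nu u) t g x := by
  have hlu : 0 ≤ lam 0 * u 0 := mul_nonneg (hirr.birth_pos 0).le (hu 0).le
  set gN : ℕ → ℕ → ℝ := fun N z => if z < N then g z else 0 with hgN
  set fN : ℕ → ℕ → ℝ := fun N x => ∑ z ∈ Finset.range x, u z * gN N z
  set f : ℕ → ℝ := fun x => ∑ z ∈ Finset.range x, u z * g z
  have hgN0 : ∀ N z, 0 ≤ gN N z := fun N z => by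
    simp only [hgN]; split_ifs; exacts [hg z, le_rfl]
  have hgNg : ∀ N z, gN N z ≤ g z := fun N z => by
    simp only [hgN]; split_ifs; exacts [le_rfl, hg z]
  have hgNC : ∀ N z, |gN N z| ≤ C := fun N z => by
    rw [abs_of_nonneg (hgN0 N z)]; exact (hgNg N z).trans (hgC z)
  have hgNm : ∀ z, Monotone fun N => gN N z := fun z M N hMN => by
    simp only [hgN]
    split_ifs
    exacts [le_rfl, absurd (lt_of_lt_of_le ‹z < M› hMN) ‹_›, hg z, le_rfl]
  have hgNt : ∀ z, Tendsto (fun N => gN N z) atTop (𝓝 (g z)) := fun z => by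
    refine tendsto_const_nhds.congr' ?_
    filter_upwards [eventually_gt_atTop z] with N hN
    simp [hgN, hN]
  have hgNY : ∀ N z, N ≤ z → gN N z = 0 := fun N z hz => by simp [hgN, hz.not_gt]
  have hfN0 : ∀ N x, 0 ≤ fN N x := fun N x =>
    Finset.sum_nonneg fun z _ => mul_nonneg (hu z).le (hgN0 N z)
  have hfNm : ∀ x, Monotone fun N => fN N x := fun x M N hMN =>
    Finset.sum_le_sum fun z _ => mul_le_mul_of_nonneg_left (hgNm z hMN) (hu z).le
  have hfNt : ∀ x, Tendsto (fun N => fN N x) atTop (𝓝 (f x)) := fun x =>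
    tendsto_finsetSum _ fun z _ => (hgNt z).const_mul _
  have hfNi : ∀ N x, Integrable (fun ω => ext (fN N) (process lam nu x t ω)) noise := fun N x =>
    integrable_ext_process (rate_pos hirr) (fun y => by
      rw [abs_of_nonneg (hfN0 N y)]
      exact sum_range_le_of_support hu (hgN0 N) (hgNY N) y) ht x
  have hid : ∀ N x, semigroup lam nu t (fN N) x = _ := fun N x =>
    semigroup_sum_of_finite_support hirr hne hu (hgN0 N) (hgNY N) hK
      (fun z => (le_abs_self _).trans (hgNC N z)) hV ht x
  -- The bound is uniform in `N`, although `f` itself may be unbounded; this gives integrability in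
  -- the limit.
  have hbound : ∀ N x, semigroup lam nu t (fN N) x ≤ lam 0 * u 0 * (C * Real.exp (K * t) * t) +
      ∑ z ∈ Finset.range x, u z * (C * Real.exp (K * t)) := by
    intro N x
    rw [hid]
    have h1 : ∫ s in (0 : ℝ)..t, feynmanKac (modBirth lam u) (modDeath nu u) (potential lam nu u)
        s (gN N) 0 ≤ C * Real.exp (K * t) * t := by
      have hC : 0 ≤ C := (hg 0).trans (hgC 0)
      have := intervalIntegral.norm_integral_le_of_norm_le_const (a := 0) (b := t)
        (f := fun s => feynmanKac (modBirth lam u) (modDeath nu u) (potential lam nu u) s (gN N) 0)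
        (C := C * Real.exp (K * t)) fun s hs => by
          rw [uIoc_of_le ht] at hs
          refine (abs_feynmanKac_le (hgNC N) hK hV hs.1.le 0).trans ?_
          have := hs.2
          gcongr
      rw [sub_zero, abs_of_nonneg ht] at this
      exact (le_abs_self _).trans this
    refine add_le_add (mul_le_mul_of_nonneg_left h1 hlu) (Finset.sum_le_sum fun z _ => ?_)
    exact mul_le_mul_of_nonneg_left
      ((le_abs_self _).trans (abs_feynmanKac_le (hgNC N) hK hV ht z)) (hu z).le
  have hf0 : ∀ o, 0 ≤ ext f o := fun o => by
    cases o with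
    | none => exact le_rfl
    | some y => exact Finset.sum_nonneg fun z _ => mul_nonneg (hu z).le (hg z)
  have hfNe0 : ∀ N o, 0 ≤ ext (fN N) o := fun N o => by
    cases o with
    | none => exact le_rfl
    | some y => exact hfN0 N y
  have hint : ∀ x, Integrable (fun ω => ext f (process lam nu x t ω)) noise := by
    intro x
    refine ⟨aestronglyMeasurable_ext_process (rate_pos hirr) f ht x, ?_⟩
    rw [hasFiniteIntegral_iff_ofReal (ae_of_all _ fun ω => hf0 _)]
    have hlim := lintegral_tendsto_of_tendsto_of_monotone (μ := noise)
      (f := fun N ω => ENNReal.ofReal (ext (fN N) (process lam nu x t ω)))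
      (F := fun ω => ENNReal.ofReal (ext f (process lam nu x t ω)))
      (fun N => (hfNi N x).aemeasurable.ennreal_ofReal)
      (ae_of_all _ fun ω M N hMN => ENNReal.ofReal_le_ofReal (ext_mono (fun y => hfNm y hMN) _))
      (ae_of_all _ fun ω => ENNReal.tendsto_ofReal (tendsto_ext hfNt _))
    refine lt_of_le_of_lt (le_of_tendsto' hlim fun N => ?_)
      (ENNReal.ofReal_lt_top (r := lam 0 * u 0 * (C * Real.exp (K * t) * t) +
        ∑ z ∈ Finset.range x, u z * (C * Real.exp (K * t))))
    rw [← ofReal_integral_eq_lintegral_ofReal (hfNi N x) (ae_of_all _ fun ω => hfNe0 N _)]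
    exact ENNReal.ofReal_le_ofReal (hbound N x)
  have hsg : ∀ x, Tendsto (fun N => semigroup lam nu t (fN N) x) atTop
      (𝓝 (semigroup lam nu t f x)) := fun x =>
    integral_tendsto_of_tendsto_of_monotone (hfNi · x) (hint x)
      (ae_of_all _ fun ω M N hMN => ext_mono (fun y => hfNm y hMN) _)
      (ae_of_all _ fun ω => tendsto_ext hfNt _)
  have hfk : Tendsto (fun N => feynmanKac (modBirth lam u) (modDeath nu u) (potential lam nu u) t
      (gN N) x) atTop
      (𝓝 (feynmanKac (modBirth lam u) (modDeath nu u) (potential lam nu u) t g x)) :=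
    integral_tendsto_of_tendsto_of_monotone
      (fun N => integrable_feynmanKacWeight (modRate_pos hirr hu) (hgNC N) hK hV ht x)
      (integrable_feynmanKacWeight (modRate_pos hirr hu)
        (fun z => by rw [abs_of_nonneg (hg z)]; exact hgC z) hK hV ht x)
      (ae_of_all _ fun ω M N hMN =>
        mul_le_mul_of_nonneg_right (ext_mono (fun y => hgNm y hMN) _) (Real.exp_pos _).le)
      (ae_of_all _ fun ω => (tendsto_ext hgNt _).mul_const _)
  refine ⟨hint x, tendsto_nhds_unique ((hsg (x + 1)).sub (hsg x)) ?_⟩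
  -- In the difference between `x + 1` and `x` the time integral at `0` cancels and only the term `z
  -- = x` remains.
  refine (hfk.const_mul (u x)).congr fun N => ?_
  rw [hid, hid, Finset.sum_range_succ]
  ring

theorem eq_add_sum_grad (hu : ∀ x, 0 < u x) (f : ℕ → ℝ) (x : ℕ) :
    f x = f 0 + ∑ z ∈ Finset.range x, u z * grad u f z := by
  have : ∀ z, u z * grad u f z = f (z + 1) - f z := fun z => mul_div_cancel₀ _ (hu z).ne'
  simp only [this, Finset.sum_range_sub]
  ring

/-- The intertwining relation for a function with bounded weighted gradient. -/
theorem intertwining (hirr : IsIrreducible lam nu) (hne : NonExplosive lam nu)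
    (hu : ∀ x, 0 < u x) {f : ℕ → ℝ} {C K : ℝ} (hf : ∀ x, |grad u f x| ≤ C) (hK : 0 ≤ K)
    (hV : ∀ x, -K ≤ potential lam nu u x) {t : ℝ} (ht : 0 ≤ t) :
    (∀ x, Integrable (fun ω => ext f (process lam nu x t ω)) noise) ∧ ∀ x,
    grad u (semigroup lam nu t f) x =
      feynmanKac (modBirth lam u) (modDeath nu u) (potential lam nu u) t (grad u f) x := by
  have hC : 0 ≤ C := (abs_nonneg _).trans (hf 0)
  set F₁ : ℕ → ℝ := fun x => ∑ z ∈ Finset.range x, u z * (grad u f z + C) with hF₁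
  set F₂ : ℕ → ℝ := fun x => ∑ z ∈ Finset.range x, u z * C with hF₂
  have h₁ := intertwining_of_nonneg hirr hne hu (g := fun z => grad u f z + C)
    (fun z => by linarith [(abs_le.1 (hf z)).1]) hK (C := 2 * C)
    (fun z => by linarith [(abs_le.1 (hf z)).2]) hV ht
  have h₂ := intertwining_of_nonneg hirr hne hu (g := fun _ => C)
    (fun _ => hC) hK (fun _ => le_rfl) hV ht
  -- The factor `1` stands for the constant function, which the non-explosive semigroup preserves.
  have hfe : ∀ y, f y = f 0 * 1 + F₁ y - F₂ y := fun y => by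
    rw [eq_add_sum_grad hu f y]
    simp only [hF₁, hF₂, mul_add, Finset.sum_add_distrib]
    ring
  have hext : ∀ o, ext f o = f 0 * ext (fun _ => 1) o + ext F₁ o - ext F₂ o := fun o => by
    cases o with
    | none => simp [ext]
    | some y => exact hfe y
  have hone : ∀ x, Integrable (fun ω => ext (fun _ => 1) (process lam nu x t ω)) noise := fun x =>
    integrable_ext_process (C := 1) (rate_pos hirr) (fun _ => by simp) ht x
  have hi : ∀ x, Integrable (fun ω => f 0 * ext (fun _ => 1) (process lam nu x t ω) +
      ext F₁ (process lam nu x t ω)) noise := fun x => ((hone x).const_mul _).add (h₁ x).1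
  have hsg : ∀ x, semigroup lam nu t f x =
      f 0 + semigroup lam nu t F₁ x - semigroup lam nu t F₂ x := fun x => by
    have h1 := semigroup_one hne t x
    rw [semigroup] at h1
    simp only [semigroup, hext]
    rw [integral_sub (hi x) (h₂ x).1, integral_add ((hone x).const_mul _) (h₁ x).1,
      integral_const_mul, h1, mul_one]
  refine ⟨fun x => by simp only [hext]; exact (hi x).sub (h₂ x).1, fun x => ?_⟩
  have hfk : feynmanKac (modBirth lam u) (modDeath nu u) (potential lam nu u) t (grad u f) x =
      feynmanKac (modBirth lam u) (modDeath nu u) (potential lam nu u) t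
        (fun z => grad u f z + C) x -
      feynmanKac (modBirth lam u) (modDeath nu u) (potential lam nu u) t (fun _ => C) x := by
    rw [feynmanKac, feynmanKac, feynmanKac, ← integral_sub]
    · refine integral_congr_ae (ae_of_all _ fun ω => ?_)
      simp only [feynmanKacWeight]
      rw [← sub_mul]
      congr 1
      cases process (modBirth lam u) (modDeath nu u) x t ω <;> simp [ext]
    · exact integrable_feynmanKacWeight (C := C + C) (modRate_pos hirr hu)
        (fun z => (abs_add_le _ _).trans (add_le_add (hf z) (abs_of_nonneg hC).le)) hK hV ht x
    · exact integrable_feynmanKacWeight (modRate_pos hirr hu)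
        (fun z => (abs_of_nonneg hC).le) hK hV ht x
  have e₁ := (h₁ x).2
  have e₂ := (h₂ x).2
  rw [hfk, grad, hsg, hsg, div_eq_iff (hu x).ne']
  simp only [← hF₁, ← hF₂] at e₁ e₂
  linarith

end Intertwining

/-! ### Convex functions -/

/-- The gap `ψ s = φ r * exp (-(c s)) - φ (r * exp (-s))` vanishes at `0`, and `h` at the point `r *
exp (-s)` gives `ψ' ≥ -c ψ`. -/
theorem map_mul_exp_neg_le {φ : ℝ → ℝ} {c : ℝ} (hφ : Differentiable ℝ φ)
    (h : ∀ r, c * φ r ≤ deriv φ r * r) (r : ℝ) {a : ℝ} (ha : 0 ≤ a) :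
    φ (r * Real.exp (-a)) ≤ φ r * Real.exp (-(c * a)) := by
  have hder : ∀ s, HasDerivAt (fun s => φ r * Real.exp (-(c * s)) - φ (r * Real.exp (-s)))
      (φ r * (Real.exp (-(c * s)) * -(c * 1)) -
        deriv φ (r * Real.exp (-s)) * (r * (Real.exp (-s) * -1))) s := fun s => by
    refine HasDerivAt.sub ?_ ?_
    · exact (((hasDerivAt_id s).const_mul c).neg.exp).const_mul _
    · exact (hφ _).hasDerivAt.comp s (((hasDerivAt_id s).neg.exp).const_mul r)
  have h0 := nonneg_of_neg_mul_le_deriv (a := c) ha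
    (fun s _ => (hder s).continuousAt.continuousWithinAt) (fun s _ => hder s)
    (fun s _ => by have := h (r * Real.exp (-s)); linarith) (by simp)
  linarith

theorem map_feynmanKac_le {b d V g : ℕ → ℝ} (hq : ∀ x, 0 < b x + d x) {C : ℝ}
    (hg : ∀ x, |g x| ≤ C) (hV : ∀ x, 0 ≤ V x) {φ : ℝ → ℝ} {c : ℝ} (hφ : Differentiable ℝ φ)
    (hconv : ConvexOn ℝ univ φ) (hc : 0 < c) (h : ∀ r, c * φ r ≤ deriv φ r * r)
    {t : ℝ} (ht : 0 ≤ t) (x : ℕ) :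
    Integrable (feynmanKacWeight b d (fun y => c * V y) t (fun y => φ (g y)) x) noise ∧
      φ (feynmanKac b d V t g x) ≤ feynmanKac b d (fun y => c * V y) t (fun y => φ (g y)) x := by
  obtain ⟨D, hD⟩ := (isCompact_Icc (a := -C) (b := C)).exists_bound_of_continuousOn
    hφ.continuous.continuousOn
  have hV' : ∀ x, -0 ≤ V x := fun x => by simpa using hV x
  have hi := integrable_feynmanKacWeight (V := fun y => c * V y) (K := 0) hq
    (g := fun y => φ (g y)) (fun y => hD _ (abs_le.1 (hg y))) le_rfl
    (fun y => by simpa using mul_nonneg hc.le (hV y)) ht x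
  have hiZ := integrable_feynmanKacWeight hq hg le_rfl hV' ht x
  have hiφ : Integrable (φ ∘ feynmanKacWeight b d V t g x) noise :=
    Integrable.of_bound (hφ.continuous.comp_aestronglyMeasurable hiZ.1) D
      (ae_of_all _ fun ω => hD _ (abs_le.1 (by
        simpa using abs_feynmanKacWeight_le (b := b) (d := d) hg le_rfl hV' ht x ω)))
  refine ⟨hi, (hconv.map_integral_le hφ.continuous.continuousOn isClosed_univ
    (ae_of_all _ fun _ => mem_univ _) hiZ hiφ).trans (integral_mono hiφ hi fun ω => ?_)⟩
  have hext : ∀ o, ext (fun y => c * V y) o = c * ext V o := fun o => by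
    cases o <;> simp [ext]
  simp only [feynmanKacWeight, hext, intervalIntegral.integral_const_mul]
  cases process b d x t ω with
  | none =>
    -- After explosion the left side is `φ 0` and the right side is `0`; the hypothesis at `r = 0`
    -- forces `φ 0 ≤ 0`.
    have h0 : c * φ 0 ≤ 0 := by simpa using h 0
    simpa [ext] using nonpos_of_mul_nonpos_right h0 hc
  | some y =>
    refine map_mul_exp_neg_le hφ h (g y) ?_
    simpa using neg_mul_le_integral_process (b := b) (d := d) le_rfl hV' ht x ω

end BirthDeath

theorem mainTheorem1 (lam nu u : ℕ → ℝ)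
    (hirr : BirthDeath.IsIrreducible lam nu)
    (hne : BirthDeath.NonExplosive lam nu)
    (hu : ∀ x, 0 < u x)
    (hV : BddBelow (Set.range (BirthDeath.potential lam nu u)))
    (f : ℕ → ℝ)
    (hf : BddAbove (Set.range fun y => |BirthDeath.grad u f y|))
    (x : ℕ) (t : ℝ) (ht : 0 ≤ t) :
    (∀ y, MeasureTheory.Integrable
      (fun ω => BirthDeath.ext f (BirthDeath.process lam nu y t ω)) BirthDeath.noise) ∧
    MeasureTheory.Integrable
      (BirthDeath.feynmanKacWeight (BirthDeath.modBirth lam u) (BirthDeath.modDeath nu u)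
        (BirthDeath.potential lam nu u) t (BirthDeath.grad u f) x) BirthDeath.noise ∧
    BirthDeath.grad u (BirthDeath.semigroup lam nu t f) x =
      BirthDeath.feynmanKac (BirthDeath.modBirth lam u) (BirthDeath.modDeath nu u)
        (BirthDeath.potential lam nu u) t (BirthDeath.grad u f) x ∧
    ((∀ y, 0 ≤ BirthDeath.potential lam nu u y) →
      ∀ (φ : ℝ → ℝ) (c : ℝ), Differentiable ℝ φ → ConvexOn ℝ Set.univ φ → 0 < c →
        (∀ r, c * φ r ≤ deriv φ r * r) →
        MeasureTheory.Integrable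
          (BirthDeath.feynmanKacWeight (BirthDeath.modBirth lam u) (BirthDeath.modDeath nu u)
            (fun y => c * BirthDeath.potential lam nu u y) t
            (fun y => φ (BirthDeath.grad u f y)) x) BirthDeath.noise ∧
        φ (BirthDeath.grad u (BirthDeath.semigroup lam nu t f) x) ≤
          BirthDeath.feynmanKac (BirthDeath.modBirth lam u) (BirthDeath.modDeath nu u)
            (fun y => c * BirthDeath.potential lam nu u y) t
            (fun y => φ (BirthDeath.grad u f y)) x) := by
  obtain ⟨C, hC⟩ := hf
  obtain ⟨m, hm⟩ := hV
  have hfC : ∀ y, |BirthDeath.grad u f y| ≤ C := fun y => hC (Set.mem_range_self y)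
  -- The lower bound is lowered to be nonpositive, since the potential is extended by `0` at the
  -- cemetery.
  have hK : ∀ y, -max (-m) 0 ≤ BirthDeath.potential lam nu u y := fun y =>
    (neg_le.1 (le_max_left (-m) 0)).trans (hm (Set.mem_range_self y))
  obtain ⟨hint, hid⟩ := BirthDeath.intertwining hirr hne hu hfC (le_max_right _ _) hK ht
  refine ⟨hint, BirthDeath.integrable_feynmanKacWeight (BirthDeath.modRate_pos hirr hu) hfC
    (le_max_right _ _) hK ht x, hid x, fun hV0 φ c hφ hconv hc h => ?_⟩
  rw [hid x]
  exact BirthDeath.map_feynmanKac_le (BirthDeath.modRate_pos hirr hu) hfC hV0 hφ hconv hc h ht x
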